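/- Let $\Gamma$ and $\Lambda$ be (associative, unital) rings; $\mathrm{Mod}(R)$ denotes the category of all left modules over a ring $R$, $\mathrm{mod}(R)$ its full subcategory of finitely generated modules, and $R^{\mathrm{o}}$ the opposite ring. Let $T={}_\Gamma T_\Lambda$ be a $(\Gamma,\Lambda)$-bimodule which is a Wakamatsu tilting module for the pair $(\Gamma,\Lambda)$, that is: (W1) the modules ${}_\Gamma T$ and $T_\Lambda$ admit resolutions by finitely generated projective modules; (W2) $\mathrm{Ext}^i_\Gamma(T,T)=0$ and $\mathrm{Ext}^i_{\Lambda^{\mathrm{o}}}(T,T)=0$ for all $i>0$; (W3) the canonical maps $\Lambda\to\mathrm{Hom}_\Gamma(T,T)$, $\lambda\mapsto(t\mapsto t\lambda)$, and $\Gamma\to\mathrm{Hom}_{\Lambda^{\mathrm{o}}}(T,T)$, $\gamma\mapsto(t\mapsto\gamma t)$, are isomorphisms (of $(\Lambda,\Lambda)$-bimodules and of $(\Gamma,\Gamma)$-bimodules, respectively). Assume that the projective dimensions $\mathrm{pd}_\Gamma T$ and $\mathrm{pd}_{\Lambda^{\mathrm{o}}}T$ are finite. Let $\mathrm{Tor}^\Lambda_i(T,-)\colon\mathrm{Mod}(\Lambda)\to\mathrm{Mod}(\Gamma)$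 and $\mathrm{Ext}^i_\Gamma(T,-)\colon\mathrm{Mod}(\Gamma)\to\mathrm{Mod}(\Lambda)$ be the $i$-th left derived functor of $T\otimes_\Lambda-$ and the $i$-th right derived functor of $\mathrm{Hom}_\Gamma(T,-)$; both are zero for $i<0$. Then for every $\ell\in\mathbb{Z}$ the functors $\mathrm{Tor}^\Lambda_\ell(T,-)$ (left adjoint) and $\mathrm{Ext}^\ell_\Gamma(T,-)$ (right adjoint) restrict to an adjoint equivalence $$\{M\in\mathrm{Mod}(\Lambda)\mid\mathrm{Tor}^\Lambda_i(T,M)=0\text{ for all }i\neq\ell\}\;\rightleftarrows\;\{N\in\mathrm{Mod}(\Gamma)\mid\mathrm{Ext}^i_\Gamma(T,N)=0\text{ for all }i\neq\ell\}$$ of full subcategories, where $i$ ranges over $\mathbb{Z}$. If, moreover, $\Gamma$ and $\Lambda$ are artin algebras (each is an algebra over some commutative artinian ring over which it is finitely generated as a module) and the modules ${}_\Gamma T$ and $T_\Lambda$ are finitely generated, then the same holds with $\mathrm{Mod}(\Lambda)$ and $\mathrm{Mod}(\Gamma)$ replaced by $\mathrm{mod}(\Lambda)$ and $\mathrm{mod}(\Gamma)$.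 -/

import Mathlib

open CategoryTheory MulOpposite
open scoped TensorProduct

universe u

set_option linter.unusedSectionVars false

noncomputable section

namespace Bimod

variable (Γ Λ : Type u) [Ring Γ] [Ring Λ]
variable (T : Type u) [AddCommGroup T] [Module Γ T] [Module Λᵐᵒᵖ T] [SMulCommClass Γ Λᵐᵒᵖ T]

/-! A `(Γ, Λ)`-bimodule `T` is a left `Γ`-module which is a right `Λ`-module, that is, a module over
the opposite ring `Λᵐᵒᵖ`, such that the two actions commute; `op l • t` is the product `t l`. -/

variable {Λ} in
/-- Right multiplication `t ↦ t l`, as a `Γ`-linear endomorphism of `T`. -/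
def rightMul (l : Λ) : T →ₗ[Γ] T where
  toFun t := op l • t
  map_add' := smul_add (op l)
  map_smul' g t := (smul_comm g (op l) t).symm

variable {Γ} in
/-- Left multiplication `t ↦ g t`, as a `Λᵐᵒᵖ`-linear endomorphism of `T`. -/
def leftMul (g : Γ) : T →ₗ[Λᵐᵒᵖ] T where
  toFun t := g • t
  map_add' := smul_add g
  map_smul' l t := smul_comm g l t

/-! ### The tensor product `T ⊗_Λ M` over a noncommutative ring -/

section Tensor

variable (M : Type u) [AddCommGroup M] [Module Λ M]

/-- The subgroup of `T ⊗_ℤ M` generated by all elements `t l ⊗ m - t ⊗ l m`. The set of these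
elements is stable under `Γ`, so the subgroup and the `Γ`-submodule they generate coincide. -/
def balancing : Submodule Γ (T ⊗[ℤ] M) :=
  Submodule.span Γ {x | ∃ (t : T) (l : Λ) (m : M), x = (op l • t) ⊗ₜ[ℤ] m - t ⊗ₜ[ℤ] (l • m)}

/-- The left `Γ`-module `T ⊗_Λ M`. -/
abbrev Tens : Type u := (T ⊗[ℤ] M) ⧸ balancing Γ Λ T M

variable {M} {M' : Type u} [AddCommGroup M'] [Module Λ M']

/-- The map `T ⊗_ℤ f`, as a `Γ`-linear map. -/
def tensMapInt (f : M →ₗ[Λ] M') : T ⊗[ℤ] M →ₗ[Γ] T ⊗[ℤ] M' :=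
  TensorProduct.AlgebraTensorModule.map (LinearMap.id : T →ₗ[Γ] T) (f.toAddMonoidHom.toIntLinearMap)

@[simp]
theorem tensMapInt_tmul (f : M →ₗ[Λ] M') (t : T) (m : M) :
    tensMapInt Γ Λ T f (t ⊗ₜ[ℤ] m) = t ⊗ₜ[ℤ] f m := rfl

theorem balancing_le (f : M →ₗ[Λ] M') :
    balancing Γ Λ T M ≤ (balancing Γ Λ T M').comap (tensMapInt Γ Λ T f) := by
  refine Submodule.span_le.2 ?_
  rintro _ ⟨t, l, m, rfl⟩
  refine Submodule.subset_span ⟨t, l, f m, ?_⟩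
  simp

/-- The map `T ⊗_Λ f : T ⊗_Λ M → T ⊗_Λ M'`, `t ⊗ m ↦ t ⊗ f m`. -/
def tensMap (f : M →ₗ[Λ] M') : Tens Γ Λ T M →ₗ[Γ] Tens Γ Λ T M' :=
  Submodule.mapQ _ _ (tensMapInt Γ Λ T f) (balancing_le Γ Λ T f)

@[simp]
theorem tensMap_mk (f : M →ₗ[Λ] M') (t : T) (m : M) :
    tensMap Γ Λ T f (Submodule.Quotient.mk (t ⊗ₜ[ℤ] m)) = Submodule.Quotient.mk (t ⊗ₜ[ℤ] f m) :=
  rfl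

variable {Γ Λ T} in
theorem tens_hom_ext {N : Type u} [AddCommGroup N] [Module Γ N] {f g : Tens Γ Λ T M →ₗ[Γ] N}
    (h : ∀ (t : T) (m : M), f (Submodule.Quotient.mk (t ⊗ₜ[ℤ] m)) =
      g (Submodule.Quotient.mk (t ⊗ₜ[ℤ] m))) : f = g := by
  refine LinearMap.ext fun x => ?_
  obtain ⟨y, rfl⟩ := Submodule.Quotient.mk_surjective _ x
  induction y using TensorProduct.induction_on with
  | zero => simp
  | tmul t m => exact h t m
  | add a b ha hb => rw [Submodule.Quotient.mk_add, map_add, map_add, ha, hb]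

end Tensor

/-- The functor `T ⊗_Λ - : Mod Λ ⥤ Mod Γ`. -/
def tensorFunctor : ModuleCat.{u} Λ ⥤ ModuleCat.{u} Γ where
  obj M := ModuleCat.of Γ (Tens Γ Λ T M)
  map f := ModuleCat.ofHom (tensMap Γ Λ T f.hom)
  map_id M := by
    ext1
    exact tens_hom_ext fun t m => rfl
  map_comp f g := by
    ext1
    exact tens_hom_ext fun t m => rfl

instance : (tensorFunctor Γ Λ T).Additive where
  map_add {M M' f g} := by
    ext1
    refine tens_hom_ext fun t m => ?_
    change (Submodule.Quotient.mk (t ⊗ₜ[ℤ] (f.hom m + g.hom m)) : Tens Γ Λ T M') =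
      Submodule.Quotient.mk (t ⊗ₜ[ℤ] f.hom m) + Submodule.Quotient.mk (t ⊗ₜ[ℤ] g.hom m)
    rw [TensorProduct.tmul_add, Submodule.Quotient.mk_add]

/-! ### The left `Λ`-module `Hom_Γ(T, N)` -/

section Hom

variable (N : Type u) [AddCommGroup N] [Module Γ N]

/-- The group `Hom_Γ(T, N)`; the ring `Λ` acts on it from the left through `T`. -/
def Homs (Γ _Λ T N : Type u) [Ring Γ] [AddCommGroup T] [Module Γ T]
    [AddCommGroup N] [Module Γ N] : Type u := T →ₗ[Γ] N

instance : AddCommGroup (Homs Γ Λ T N) := inferInstanceAs (AddCommGroup (T →ₗ[Γ] N))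

variable {Γ Λ T N} in
/-- An element of `Hom_Γ(T, N)` as a linear map. -/
def Homs.toLin (f : Homs Γ Λ T N) : T →ₗ[Γ] N := f

/-- The action `(l • f) t = f (t l)`. -/
instance : Module Λ (Homs Γ Λ T N) where
  smul l f := f.toLin.comp (rightMul Γ T l)
  one_smul f := by
    refine LinearMap.ext (σ := RingHom.id Γ) fun t => ?_
    change f.toLin (op (1 : Λ) • t) = f.toLin t
    rw [op_one, one_smul]
  mul_smul l l' f := by
    refine LinearMap.ext (σ := RingHom.id Γ) fun t => ?_
    change f.toLin (op (l * l') • t) = f.toLin (op l' • op l • t)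
    rw [op_mul, mul_smul]
  smul_zero l := rfl
  smul_add l f g := rfl
  add_smul l l' f := by
    refine LinearMap.ext (σ := RingHom.id Γ) fun t => ?_
    change f.toLin (op (l + l') • t) = f.toLin (op l • t) + f.toLin (op l' • t)
    rw [MulOpposite.op_add, add_smul, map_add]
  zero_smul f := by
    refine LinearMap.ext (σ := RingHom.id Γ) fun t => ?_
    change f.toLin (op (0 : Λ) • t) = 0
    rw [op_zero, zero_smul, map_zero]

variable {N} {N' : Type u} [AddCommGroup N'] [Module Γ N']

/-- The map `Hom_Γ(T, g) : Hom_Γ(T, N) → Hom_Γ(T, N')`, `f ↦ g ∘ f`. -/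
def homsMap (g : N →ₗ[Γ] N') : Homs Γ Λ T N →ₗ[Λ] Homs Γ Λ T N' where
  toFun f := g.comp f.toLin
  map_add' f f' := LinearMap.comp_add f.toLin f'.toLin g
  map_smul' _ _ := rfl

end Hom

/-- The functor `Hom_Γ(T, -) : Mod Γ ⥤ Mod Λ`. -/
def homFunctor : ModuleCat.{u} Γ ⥤ ModuleCat.{u} Λ where
  obj N := ModuleCat.of Λ (Homs Γ Λ T N)
  map g := ModuleCat.ofHom (homsMap Γ Λ T g.hom)
  map_id _ := rfl
  map_comp _ _ := rfl

instance : (homFunctor Γ Λ T).Additive where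
  map_add := rfl

/-! ### `Tor` and `Ext` as derived functors, indexed by all integers -/

/-- `Tor^Λ_i(T, -) : Mod Λ ⥤ Mod Γ`, the `i`-th left derived functor of `T ⊗_Λ -`; it is zero
for `i < 0`. -/
def torFunctor : ℤ → (ModuleCat.{u} Λ ⥤ ModuleCat.{u} Γ)
  | Int.ofNat n => (tensorFunctor Γ Λ T).leftDerived n
  | Int.negSucc _ => (Functor.const _).obj (ModuleCat.of Γ PUnit)

/-- `Ext^i_Γ(T, -) : Mod Γ ⥤ Mod Λ`, the `i`-th right derived functor of `Hom_Γ(T, -)`; it is zero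
for `i < 0`. -/
def extFunctor : ℤ → (ModuleCat.{u} Γ ⥤ ModuleCat.{u} Λ)
  | Int.ofNat n => (homFunctor Γ Λ T).rightDerived n
  | Int.negSucc _ => (Functor.const _).obj (ModuleCat.of Λ PUnit)

/-- The modules `M ∈ Mod Λ` with `Tor^Λ_i(T, M) = 0` for all integers `i ≠ ℓ`. -/
def torConcentrated (ℓ : ℤ) : ObjectProperty (ModuleCat.{u} Λ) :=
  fun M => ∀ i : ℤ, i ≠ ℓ → Limits.IsZero ((torFunctor Γ Λ T i).obj M)

/-- The modules `N ∈ Mod Γ` with `Ext^i_Γ(T, N) = 0` for all integers `i ≠ ℓ`. -/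
def extConcentrated (ℓ : ℤ) : ObjectProperty (ModuleCat.{u} Γ) :=
  fun N => ∀ i : ℤ, i ≠ ℓ → Limits.IsZero ((extFunctor Γ Λ T i).obj N)

/-- The finitely generated modules. -/
def fg (R : Type u) [Ring R] : ObjectProperty (ModuleCat.{u} R) := fun M => Module.Finite R M

/-- The module `M` has a resolution by finitely generated projective modules. -/
def HasFGProjectiveResolution (R : Type u) [Ring R] (M : Type u) [AddCommGroup M] [Module R M] :
    Prop :=
  ∃ P : ProjectiveResolution (ModuleCat.of R M), ∀ n : ℕ, Module.Finite R (P.complex.X n)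

/-- A Wakamatsu tilting module for the pair `(Γ, Λ)`. -/
structure IsWakamatsuTilting : Prop where
  resolution_left : HasFGProjectiveResolution Γ T
  resolution_right : HasFGProjectiveResolution Λᵐᵒᵖ T
  ext_left : ∀ i : ℕ, 0 < i →
    Subsingleton (Abelian.Ext.{u} (ModuleCat.of Γ T) (ModuleCat.of Γ T) i)
  ext_right : ∀ i : ℕ, 0 < i →
    Subsingleton (Abelian.Ext.{u} (ModuleCat.of Λᵐᵒᵖ T) (ModuleCat.of Λᵐᵒᵖ T) i)
  /-- The canonical map `Λ → Hom_Γ(T, T)`, `l ↦ (t ↦ t l)`, is an isomorphism. (It is always a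
  homomorphism of bimodules.) -/
  homothety_right : Function.Bijective fun l : Λ => rightMul Γ T l
  /-- The canonical map `Γ → Hom_{Λᵐᵒᵖ}(T, T)`, `g ↦ (t ↦ g t)`, is an isomorphism. (It is always
  a homomorphism of bimodules.) -/
  homothety_left : Function.Bijective fun g : Γ => leftMul Λ T g

/-- A ring is an artin algebra if it is a finitely generated module over some commutative artinian
ring over which it is an algebra. -/
def IsArtinAlgebra (R : Type u) [Ring R] : Prop :=
  ∃ (k : Type u) (_ : CommRing k) (_ : IsArtinianRing k) (_ : Algebra k R), Module.Finite k R

/-- The functors `F` and `G` restrict to an adjoint equivalence between the full subcategories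
given by `P` and `Q`: they send `P` into `Q` and `Q` into `P`, and the restricted functors form an
adjunction whose unit and counit are isomorphisms. -/
def RestrictsToAdjointEquivalence {C D : Type*} [Category C] [Category D] (F : C ⥤ D) (G : D ⥤ C)
    (P : ObjectProperty C) (Q : ObjectProperty D) : Prop :=
  ∃ (hF : ∀ X : P.FullSubcategory, Q ((P.ι ⋙ F).obj X))
    (hG : ∀ Y : Q.FullSubcategory, P ((Q.ι ⋙ G).obj Y))
    (adj : Q.lift (P.ι ⋙ F) hF ⊣ P.lift (Q.ι ⋙ G) hG), IsIso adj.unit ∧ IsIso adj.counit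

end Bimod

end

noncomputable section

/-! ### Morphisms between complexes concentrated in one degree -/

namespace DerivedCategory

universe w v v'

variable {C : Type v} [Category.{v'} C] [Abelian C] [HasDerivedCategory.{w} C]

/-! The functors T ⊗ᴸ - and RHom(T, -) form an adjoint pair, and the theorem says that they match
objects whose images are concentrated in one degree. The proof works with resolutions rather than
total derived functors. Let P be a projective resolution of M in degrees ≤ 0 and I an injective
resolution of N placed in degrees ≥ -ℓ. Chain maps f : T ⊗ P ⟶ I correspond to chain maps f' : P ⟶
Hom(T, I). The map induced by f on H^{-ℓ}, followed by H^{-ℓ}(I) ≅ N, is a map h : Tor_ℓ(T, M) ⟶ N;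
that of f' on H⁰ is a map g : M ⟶ Ext^ℓ(T, N). `derivedRel` relates h and g if they come from one
such f. If M is concentrated, both T ⊗ P and I have homology only in degree -ℓ, and I is
K-injective, so h determines f up to homotopy and hence determines g. Dually, g determines h if N is
concentrated, because P is K-projective.

It remains to see that identities correspond to isomorphisms and that concentration passes to the
other side (`isIso_right`, `isIso_left`). Both follow once adjuncts of quasi-isomorphisms T ⊗ P ⟶ I
or P ⟶ Hom(T, I) are quasi-isomorphisms. `DerivesToEquivalence` collects what is needed for that:
the unit is invertible on projectives, the counit is invertible on injectives, and the functors
preserve acyclicity of unbounded complexes with terms in classes W (containing injectives and all T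
⊗ P) and V (containing projectives and all Hom(T, I)).

For Hom(T, -), W consists of the modules without higher extensions by T, and pd T < ∞ permits
dimension shifting along the cycles (`exists_lift_of_acyclic`). T ⊗ P lies in W since it is a
retract of a direct sum of copies of T, and T has finitely generated syzygies. For T ⊗ -, V
(`leftAcyclic`) is a Tor-vanishing condition on right modules S'' with Extⁱ(S'', T) = 0 for i > 0,
and one inducts on projective dimension (`exists_gMapRight_d_eq`). Since syzygies of T over Λᵒ carry
no action of Γ, their tensor products are formed as abelian groups. Both Hom(T, I) ∈ V and the
invertibility of the counit rest on the evaluation map S ⊗ Hom_Γ(T, I) → Hom_Γ(Hom_Λᵒ(S, T), I),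
bijective if I is injective, Ext¹(S, T) = 0 and S has finitely generated syzygies
(`evalTens_bijective`).

For ℓ < 0 both subcategories consist of zero objects. For artin algebras Tor and Ext preserve finite
generation; the case of Ext uses that central scalars act on T through Λ (`finite_rightDerived`). -/

lemma homologyFunctor_map_bijective_of_iso_single {n : ℤ} {X Y : DerivedCategory C} {A B : C}
    (e : X ≅ (singleFunctor C n).obj A) (e' : Y ≅ (singleFunctor C n).obj B) :
    Function.Bijective (fun f : X ⟶ Y => (homologyFunctor C n).map f) := by
  let i := singleFunctorCompHomologyFunctorIso C n
  -- The single functor is fully faithful and is a section of Hⁿ up to natural isomorphism, so Hⁿ is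
  -- bijective on maps between single objects.
  have key : Function.Bijective (fun f : (singleFunctor C n).obj A ⟶ (singleFunctor C n).obj B =>
      (homologyFunctor C n).map f) := by
    refine (Function.Bijective.of_comp_iff _
      ((Functor.FullyFaithful.ofFullyFaithful (singleFunctor C n)).map_bijective A B)).1 ?_
    have : (fun f : (singleFunctor C n).obj A ⟶ (singleFunctor C n).obj B =>
        (homologyFunctor C n).map f) ∘ (singleFunctor C n).map =
        ((i.app A).homCongr (i.app B)).symm := by
      funext g
      have := i.hom.naturality g
      exact ((i.app B).eq_comp_inv.2 this).trans (Category.assoc _ _ _)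
    rw [this]
    exact Equiv.bijective _
  constructor
  · intro f f' h
    rw [← cancel_mono e'.hom, ← cancel_epi e.inv]
    refine key.1 ?_
    dsimp only at h ⊢
    simp only [Functor.map_comp, h]
  · intro h
    obtain ⟨f, hf⟩ := key.2 ((homologyFunctor C n).map e.inv ≫ h ≫ (homologyFunctor C n).map e'.hom)
    refine ⟨e.hom ≫ f ≫ e'.inv, ?_⟩
    dsimp only at hf ⊢
    simp only [Functor.map_comp, hf, Category.assoc, ← Functor.map_comp_assoc, Iso.hom_inv_id,
      CategoryTheory.Functor.map_id, Category.id_comp]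
    rw [← Functor.map_comp, Iso.hom_inv_id, CategoryTheory.Functor.map_id, Category.comp_id]

end DerivedCategory

namespace CochainComplex

universe v v'
variable {C : Type v} [Category.{v'} C] [Abelian C]

/-- The complex `K` is exact in all degrees but `n`. -/
def ExactOff (K : CochainComplex C ℤ) (n : ℤ) : Prop := ∀ i : ℤ, i ≠ n → K.ExactAt i

attribute [local instance] HasDerivedCategory.standard in
-- A complex exact off n is both ≥ n and ≤ n for the t-structure, hence isomorphic in the derived
-- category to a single object in degree n.
lemma Q_homology_bijective {K L : CochainComplex C ℤ} {n : ℤ} (hK : K.ExactOff n)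
    (hL : L.ExactOff n) : Function.Bijective
      (fun f : DerivedCategory.Q.obj K ⟶ DerivedCategory.Q.obj L =>
        (DerivedCategory.homologyFunctor C n).map f) := by
  have key (K : CochainComplex C ℤ) (hK : K.ExactOff n) : ∃ A : C,
      Nonempty (DerivedCategory.Q.obj K ≅ (DerivedCategory.singleFunctor C n).obj A) := by
    have : K.IsGE n := (CochainComplex.isGE_iff K n).2 fun i hi => hK i hi.ne
    have : K.IsLE n := (CochainComplex.isLE_iff K n).2 fun i hi => hK i hi.ne'
    exact DerivedCategory.exists_iso_singleFunctor_obj_of_isGE_of_isLE _ n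
  obtain ⟨A, ⟨e⟩⟩ := key K hK
  obtain ⟨B, ⟨e'⟩⟩ := key L hL
  exact DerivedCategory.homologyFunctor_map_bijective_of_iso_single e e'

attribute [local instance] HasDerivedCategory.standard in
-- The hypothesis `hQ` holds for K-injective targets and for K-projective sources alike, so one
-- argument serves both. It turns a map in the derived category into a homotopy class, which is then
-- represented by a chain map.
lemma exists_hom_of_Qh_bijective {K L : CochainComplex C ℤ} {n : ℤ} (hK : K.ExactOff n)
    (hL : L.ExactOff n) (hQ : Function.Bijective (DerivedCategory.Qh.map :
      ((HomotopyCategory.quotient _ _).obj K ⟶ (HomotopyCategory.quotient _ _).obj L) → _))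
    (h : K.homology n ⟶ L.homology n) :
    ∃ f : K ⟶ L, HomologicalComplex.homologyMap f n = h := by
  obtain ⟨f, hf⟩ := (Q_homology_bijective hK hL).2
    ((DerivedCategory.homologyFunctorFactors C n).hom.app K ≫ h ≫
      (DerivedCategory.homologyFunctorFactors C n).inv.app L)
  obtain ⟨g, hg⟩ := hQ.2 f
  obtain ⟨g, rfl⟩ := (HomotopyCategory.quotient _ _).map_surjective g
  have hg' : DerivedCategory.Q.map g = f := hg
  subst hg'
  refine ⟨g, ?_⟩
  have key : (DerivedCategory.homologyFunctorFactors C n).hom.app K ≫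
      HomologicalComplex.homologyMap g n =
      (DerivedCategory.homologyFunctorFactors C n).hom.app K ≫ h := by
    rw [← DerivedCategory.homologyFunctorFactors_hom_naturality]
    refine (congrArg (· ≫ _) hf).trans ((Category.assoc _ _ _).trans (congrArg (_ ≫ ·) ?_))
    refine (Category.assoc _ _ _).trans ?_
    exact (congrArg (h ≫ ·)
      ((DerivedCategory.homologyFunctorFactors C n).inv_hom_id_app L)).trans (Category.comp_id _)
  exact (((DerivedCategory.homologyFunctorFactors C n).app K).cancel_iso_hom_left _ _).1 key

attribute [local instance] HasDerivedCategory.standard in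
lemma homotopy_of_Qh_bijective {K L : CochainComplex C ℤ} {n : ℤ} (hK : K.ExactOff n)
    (hL : L.ExactOff n) (hQ : Function.Bijective (DerivedCategory.Qh.map :
      ((HomotopyCategory.quotient _ _).obj K ⟶ (HomotopyCategory.quotient _ _).obj L) → _))
    (f f' : K ⟶ L) (h : HomologicalComplex.homologyMap f n = HomologicalComplex.homologyMap f' n) :
    Nonempty (Homotopy f f') := by
  refine ⟨HomotopyCategory.homotopyOfEq _ _ (hQ.1 ?_)⟩
  change DerivedCategory.Q.map f = DerivedCategory.Q.map f'
  refine (Q_homology_bijective hK hL).1 ?_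
  dsimp only
  rw [← cancel_mono ((DerivedCategory.homologyFunctorFactors C n).hom.app L),
    DerivedCategory.homologyFunctorFactors_hom_naturality,
    DerivedCategory.homologyFunctorFactors_hom_naturality, h]

attribute [local instance] HasDerivedCategory.standard in
/-- Homotopy classes of maps between complexes concentrated in degree `n` are determined by the
maps on the `n`-th homology, if the target is K-injective. -/
lemma homotopy_classes_of_isKInjective {K L : CochainComplex C ℤ} [L.IsKInjective] {n : ℤ}
    (hK : K.ExactOff n) (hL : L.ExactOff n) :
    (∀ h : K.homology n ⟶ L.homology n, ∃ f : K ⟶ L, HomologicalComplex.homologyMap f n = h) ∧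
    ∀ f f' : K ⟶ L, HomologicalComplex.homologyMap f n = HomologicalComplex.homologyMap f' n →
      Nonempty (Homotopy f f') :=
  ⟨exists_hom_of_Qh_bijective hK hL (IsKInjective.Qh_map_bijective _ _),
    homotopy_of_Qh_bijective hK hL (IsKInjective.Qh_map_bijective _ _)⟩

attribute [local instance] HasDerivedCategory.standard in
/-- Homotopy classes of maps between complexes concentrated in degree `n` are determined by the
maps on the `n`-th homology, if the source is K-projective. -/
lemma homotopy_classes_of_isKProjective {K L : CochainComplex C ℤ} [K.IsKProjective] {n : ℤ}
    (hK : K.ExactOff n) (hL : L.ExactOff n) :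
    (∀ h : K.homology n ⟶ L.homology n, ∃ f : K ⟶ L, HomologicalComplex.homologyMap f n = h) ∧
    ∀ f f' : K ⟶ L, HomologicalComplex.homologyMap f n = HomologicalComplex.homologyMap f' n →
      Nonempty (Homotopy f f') :=
  ⟨exists_hom_of_Qh_bijective hK hL (IsKProjective.Qh_map_bijective _ _),
    homotopy_of_Qh_bijective hK hL (IsKProjective.Qh_map_bijective _ _)⟩

lemma quasiIso_of_exactOff {K L : CochainComplex C ℤ} {n : ℤ} (hK : K.ExactOff n)
    (hL : L.ExactOff n) (f : K ⟶ L) [IsIso (HomologicalComplex.homologyMap f n)] :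
    QuasiIso f := by
  refine ⟨fun i => ?_⟩
  by_cases h : i = n
  · subst h
    rw [quasiIsoAt_iff_isIso_homologyMap]
    infer_instance
  · rw [quasiIsoAt_iff_exactAt f i (hK i h)]
    exact hL i h

end CochainComplex

end

noncomputable section

/-! ### Additive functors and extensions of complexes -/

namespace HomologicalComplex

open Limits

variable {ι ι' : Type*} {c : ComplexShape ι} {c' : ComplexShape ι'}
  {C D : Type*} [Category* C] [Category* D] [Preadditive C] [Preadditive D]
  [HasZeroObject C] [HasZeroObject D]

/-- An additive functor commutes with the terms of the extension of a complex. -/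
def mapExtendXIso (F : C ⥤ D) [F.Additive] (K : HomologicalComplex C c) : ∀ o : Option ι,
    F.obj (extend.X K o) ≅ extend.X ((F.mapHomologicalComplex c).obj K) o
  | some _ => Iso.refl _
  | none => IsZero.iso (F.map_isZero (extend.isZero_X K rfl)) (extend.isZero_X _ rfl)

lemma mapExtendXIso_d (F : C ⥤ D) [F.Additive] (K : HomologicalComplex C c) (o o' : Option ι) :
    (mapExtendXIso F K o).hom ≫ extend.d ((F.mapHomologicalComplex c).obj K) o o' =
      F.map (extend.d K o o') ≫ (mapExtendXIso F K o').hom :=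
  match o, o' with
  | none, _ => (F.map_isZero (extend.isZero_X K rfl)).eq_of_src _ _
  | some _, none => (extend.isZero_X _ rfl).eq_of_tgt _ _
  | some _, some _ => (Category.id_comp _).trans (Category.comp_id _).symm

lemma mapExtendXIso_mapX (F : C ⥤ D) [F.Additive] {K L : HomologicalComplex C c} (φ : K ⟶ L)
    (o : Option ι) : F.map (extend.mapX φ o) ≫ (mapExtendXIso F L o).hom =
      (mapExtendXIso F K o).hom ≫ extend.mapX ((F.mapHomologicalComplex c).map φ) o :=
  match o with
  | none => (F.map_isZero (extend.isZero_X K rfl)).eq_of_src _ _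
  | some _ => (Category.comp_id _).trans (Category.id_comp _).symm

/-- An additive functor commutes with the extension of complexes. -/
def mapExtendIso (F : C ⥤ D) [F.Additive] (K : HomologicalComplex C c) (e : c.Embedding c') :
    (F.mapHomologicalComplex c').obj (K.extend e) ≅ ((F.mapHomologicalComplex c).obj K).extend e :=
  Hom.isoOfComponents (fun i => mapExtendXIso F K (e.r i))
    fun i j _ => mapExtendXIso_d F K (e.r i) (e.r j)

lemma mapExtendIso_naturality (F : C ⥤ D) [F.Additive] {K L : HomologicalComplex C c} (φ : K ⟶ L)
    (e : c.Embedding c') : (F.mapHomologicalComplex c').map (extendMap φ e) ≫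
        (mapExtendIso F L e).hom =
      (mapExtendIso F K e).hom ≫ extendMap ((F.mapHomologicalComplex c).map φ) e := by
  ext i
  exact mapExtendXIso_mapX F φ (e.r i)

end HomologicalComplex

namespace HomologicalComplex

open Limits

variable {ι ι' : Type*} {c : ComplexShape ι} {c' : ComplexShape ι'}
  {C D : Type*} [Category* C] [Category* D] [Abelian C] [Abelian D]

/-- The homology of `F (K.extend e)` is the homology of `F K`. -/
def mapExtendHomologyIso (F : C ⥤ D) [F.Additive] (K : HomologicalComplex C c)
    (e : c.Embedding c') [e.IsRelIff] {j : ι} {j' : ι'} (h : e.f j = j') :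
    ((F.mapHomologicalComplex c').obj (K.extend e)).homology j' ≅
      ((F.mapHomologicalComplex c).obj K).homology j :=
  (homologyFunctor D c' j').mapIso (mapExtendIso F K e) ≪≫
    extendHomologyIso ((F.mapHomologicalComplex c).obj K) e h

lemma mapExtendHomologyIso_naturality (F : C ⥤ D) [F.Additive] {K L : HomologicalComplex C c}
    (φ : K ⟶ L) (e : c.Embedding c') [e.IsRelIff] {j : ι} {j' : ι'} (h : e.f j = j') :
    homologyMap ((F.mapHomologicalComplex c').map (extendMap φ e)) j' ≫
        (mapExtendHomologyIso F L e h).hom =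
      (mapExtendHomologyIso F K e h).hom ≫
        homologyMap ((F.mapHomologicalComplex c).map φ) j := by
  change _ ≫ homologyMap _ _ ≫ _ = (homologyMap _ _ ≫ _) ≫ _
  rw [← homologyMap_comp_assoc, mapExtendIso_naturality, homologyMap_comp, Category.assoc,
    Category.assoc, extendHomologyIso_hom_naturality]

lemma map_extend_exactAt (F : C ⥤ D) [F.Additive] (K : HomologicalComplex C c)
    (e : c.Embedding c') (j' : ι') (hj' : ∀ j, e.f j ≠ j') :
    ((F.mapHomologicalComplex c').obj (K.extend e)).ExactAt j' :=
  ShortComplex.exact_of_isZero_X₂ _ (F.map_isZero (K.isZero_extend_X e j' hj'))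

end HomologicalComplex

/-! ### Adjoint functors and complexes -/

namespace CategoryTheory.Adjunction

variable {C D : Type*} [Category* C] [Category* D] [Preadditive C] [Preadditive D]
  {F : C ⥤ D} {G : D ⥤ C} [F.Additive] [G.Additive] (adj : F ⊣ G) {ι : Type*} (c : ComplexShape ι)

/-- The adjunction on complexes induced by an adjunction between additive functors. -/
def mapComplex : F.mapHomologicalComplex c ⊣ G.mapHomologicalComplex c :=
  Adjunction.mkOfUnitCounit
    { unit := { app K := { f i := adj.unit.app (K.X i)
                           comm' i j _ := (adj.unit.naturality (K.d i j)).symm }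
                naturality K L f := by
                  ext i
                  exact adj.unit.naturality (f.f i) }
      counit := { app K := { f i := adj.counit.app (K.X i)
                             comm' i j _ := (adj.counit.naturality (K.d i j)).symm }
                  naturality K L f := by
                    ext i
                    exact adj.counit.naturality (f.f i) }
      left_triangle := by
        ext K i
        refine (congrArg (_ ≫ ·) (Category.id_comp _)).trans ?_
        exact adj.left_triangle_components (K.X i)
      right_triangle := by
        ext K i
        refine (congrArg (_ ≫ ·) (Category.id_comp _)).trans ?_
        exact adj.right_triangle_components (K.X i) }

lemma isIso_mapComplex_unit_app (K : HomologicalComplex C c)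
    (h : ∀ i, IsIso (adj.unit.app (K.X i))) : IsIso ((adj.mapComplex c).unit.app K) := by
  have (i : ι) : IsIso (((adj.mapComplex c).unit.app K).f i) := h i
  exact HomologicalComplex.Hom.isIso_of_components _

lemma isIso_mapComplex_counit_app (K : HomologicalComplex D c)
    (h : ∀ i, IsIso (adj.counit.app (K.X i))) : IsIso ((adj.mapComplex c).counit.app K) := by
  have (i : ι) : IsIso (((adj.mapComplex c).counit.app K).f i) := h i
  exact HomologicalComplex.Hom.isIso_of_components _

/-- Homotopic maps have homotopic adjoints. -/
lemma homotopy_homEquiv {K : HomologicalComplex C c} {L : HomologicalComplex D c}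
    {f f' : (F.mapHomologicalComplex c).obj K ⟶ L} (h : Nonempty (Homotopy f f')) :
    Nonempty (Homotopy ((adj.mapComplex c).homEquiv K L f) ((adj.mapComplex c).homEquiv K L f')) := by
  obtain ⟨h⟩ := h
  rw [homEquiv_unit, homEquiv_unit]
  exact ⟨(G.mapHomotopy h).compLeft _⟩

lemma homotopy_homEquiv_symm {K : HomologicalComplex C c} {L : HomologicalComplex D c}
    {f f' : K ⟶ (G.mapHomologicalComplex c).obj L} (h : Nonempty (Homotopy f f')) :
    Nonempty (Homotopy (((adj.mapComplex c).homEquiv K L).symm f)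
      (((adj.mapComplex c).homEquiv K L).symm f')) := by
  obtain ⟨h⟩ := h
  rw [homEquiv_counit, homEquiv_counit]
  exact ⟨(F.mapHomotopy h).compRight _⟩

end CategoryTheory.Adjunction

/-! ### Quasi-isomorphisms and mapping cones -/

namespace CochainComplex

variable {C D : Type*} [Category* C] [Category* D] [Abelian C] [Abelian D]

/-- The cone completes f to a distinguished triangle in the homotopy category, where the
quasi-isomorphisms are the maps whose cone is acyclic. -/
lemma quasiIso_iff_mappingCone_acyclic {K L : CochainComplex C ℤ} (f : K ⟶ L) :
    QuasiIso f ↔ (mappingCone f).Acyclic := by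
  rw [← HomotopyCategory.quotient_obj_mem_subcategoryAcyclic_iff_acyclic,
    ← HomologicalComplex.mem_quasiIso_iff,
    ← HomotopyCategory.quotient_map_mem_quasiIso_iff,
    HomotopyCategory.quasiIso_eq_trW_subcategoryAcyclic]
  exact (HomotopyCategory.subcategoryAcyclic C).trW_iff_of_distinguished _
    (HomotopyCategory.mappingCone_triangleh_distinguished f)

/-- If `F` sends acyclic complexes with terms in `W` to acyclic complexes, then it sends
quasi-isomorphisms between complexes with terms in `W` to quasi-isomorphisms. -/
lemma quasiIso_map_of_acyclic (F : C ⥤ D) [F.Additive] (W : ObjectProperty C)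
    (hW : ∀ X Y, W X → W Y → W (X ⊞ Y)) [W.IsClosedUnderIsomorphisms]
    (hF : ∀ K : CochainComplex C ℤ, K.Acyclic → (∀ i, W (K.X i)) →
      ((F.mapHomologicalComplex _).obj K).Acyclic)
    {K L : CochainComplex C ℤ} (hK : ∀ i, W (K.X i)) (hL : ∀ i, W (L.X i)) (f : K ⟶ L)
    (hf : QuasiIso f) : QuasiIso ((F.mapHomologicalComplex (ComplexShape.up ℤ)).map f) := by
  rw [quasiIso_iff_mappingCone_acyclic] at hf ⊢
  -- The terms of the cone are biproducts of terms of K and L, so they lie in W, and an additive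
  -- functor commutes with cones.
  have := hF _ hf fun i => W.prop_of_iso
    (HomologicalComplex.homotopyCofiber.XIsoBiprod f i (i + 1) rfl).symm (hW _ _ (hK _) (hL _))
  exact fun i => (this i).of_iso (mappingCone.mapHomologicalComplexIso f F)

end CochainComplex

end

noncomputable section

/-! ### Adjoint equivalences from a correspondence of morphisms -/

namespace Bimod

/-- A natural correspondence between the maps `F X ⟶ Y` and the maps `X ⟶ G Y` which is a bijection
on the objects with `P` and `Q`, and which relates identities to isomorphisms there, makes `F` and
`G` restrict to an adjoint equivalence. -/
lemma restrictsToAdjointEquivalence_of_rel {C D : Type*} [Category* C] [Category* D]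
    (F : C ⥤ D) (G : D ⥤ C) (P : ObjectProperty C) (Q : ObjectProperty D)
    (R : ∀ ⦃X : C⦄ ⦃Y : D⦄, (F.obj X ⟶ Y) → (X ⟶ G.obj Y) → Prop)
    (natL : ∀ ⦃X X' : C⦄ ⦃Y : D⦄ (a : X' ⟶ X) (h : F.obj X ⟶ Y) (g : X ⟶ G.obj Y),
      R h g → R (F.map a ≫ h) (a ≫ g))
    (natR : ∀ ⦃X : C⦄ ⦃Y Y' : D⦄ (b : Y ⟶ Y') (h : F.obj X ⟶ Y) (g : X ⟶ G.obj Y),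
      R h g → R (h ≫ b) (g ≫ G.map b))
    (ex : ∀ ⦃X : C⦄ ⦃Y : D⦄, P X → ∀ h : F.obj X ⟶ Y, ∃ g, R h g)
    (uniq : ∀ ⦃X : C⦄ ⦃Y : D⦄, P X → ∀ (h : F.obj X ⟶ Y) (g g' : X ⟶ G.obj Y),
      R h g → R h g' → g = g')
    (ex' : ∀ ⦃X : C⦄ ⦃Y : D⦄, Q Y → ∀ g : X ⟶ G.obj Y, ∃ h, R h g)
    (uniq' : ∀ ⦃X : C⦄ ⦃Y : D⦄, Q Y → ∀ (h h' : F.obj X ⟶ Y) (g : X ⟶ G.obj Y),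
      R h g → R h' g → h = h')
    (hF : ∀ X, P X → Q (F.obj X)) (hG : ∀ Y, Q Y → P (G.obj Y))
    (iso : ∀ X, P X → ∀ g : X ⟶ G.obj (F.obj X), R (𝟙 (F.obj X)) g → IsIso g)
    (iso' : ∀ Y, Q Y → ∀ h : F.obj (G.obj Y) ⟶ Y, R h (𝟙 (G.obj Y)) → IsIso h) :
    RestrictsToAdjointEquivalence F G P Q := by
  -- Uniqueness makes the chosen partners mutually inverse, and with the stability of R under
  -- composition it makes them natural.
  choose φ hφ using ex
  choose ψ hψ using ex'
  let F' := Q.lift (P.ι ⋙ F) fun X => hF X.obj X.property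
  let G' := P.lift (Q.ι ⋙ G) fun Y => hG Y.obj Y.property
  let e (X : P.FullSubcategory) (Y : Q.FullSubcategory) : (F'.obj X ⟶ Y) ≃ (X ⟶ G'.obj Y) :=
    { toFun h := ObjectProperty.homMk (φ X.property h.hom)
      invFun g := ObjectProperty.homMk (ψ Y.property g.hom)
      left_inv h := by
        ext
        exact uniq' Y.property _ _ _ (hψ Y.property _) (hφ X.property _)
      right_inv g := by
        ext
        exact uniq X.property _ _ _ (hφ X.property _) (hψ Y.property _) }
  let adj : F' ⊣ G' := Adjunction.mkOfHomEquiv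
    { homEquiv := e
      homEquiv_naturality_left_symm {X' X Y} a g := by
        ext
        exact uniq' Y.property _ _ _ (hψ Y.property _)
          (natL a.hom _ _ (hψ (X := X.obj) Y.property g.hom))
      homEquiv_naturality_right {X Y Y'} h b := by
        ext
        exact uniq X.property _ _ _ (hφ X.property _)
          (natR b.hom _ _ (hφ (Y := Y.obj) X.property h.hom)) }
  refine ⟨fun X => hF X.obj X.property, fun Y => hG Y.obj Y.property, adj, ?_, ?_⟩
  · refine (NatTrans.isIso_iff_isIso_app _).2 fun X => ?_
    have h1 : (adj.unit.app X).hom = φ X.property (𝟙 (F.obj X.obj)) := by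
      rw [show adj.unit.app X = e X (F'.obj X) (𝟙 _) from
        Adjunction.mkOfHomEquiv_unit_app _ _]
      rfl
    have : IsIso (P.ι.map (adj.unit.app X)) := by
      change IsIso (adj.unit.app X).hom
      rw [h1]
      exact iso _ X.property _ (hφ X.property _)
    exact isIso_of_reflects_iso _ P.ι
  · refine (NatTrans.isIso_iff_isIso_app _).2 fun Y => ?_
    have h1 : (adj.counit.app Y).hom = ψ Y.property (𝟙 (G.obj Y.obj)) := by
      rw [show adj.counit.app Y = (e (G'.obj Y) Y).symm (𝟙 _) from
        Adjunction.mkOfHomEquiv_counit_app _ _]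
      rfl
    have : IsIso (Q.ι.map (adj.counit.app Y)) := by
      change IsIso (adj.counit.app Y).hom
      rw [h1]
      exact iso' _ Y.property _ (hψ Y.property _)
    exact isIso_of_reflects_iso _ Q.ι

end Bimod

/-! ### Resolutions as complexes indexed by the integers -/

namespace CategoryTheory

open Limits HomologicalComplex

section Resolutions

variable {A B : Type*} [Category* A] [Category* B] [Abelian A] [Abelian B]

section Projective

variable [HasProjectiveResolutions A] (F : A ⥤ B) [F.Additive]

/-- The projective resolution of `M`, as a cochain complex in nonpositive degrees. -/
abbrev projComplex (M : A) : CochainComplex A ℤ :=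
  (projectiveResolution M).complex.extend (ComplexShape.embeddingUpIntLE 0)

/-- A lift of `a : M ⟶ M'` to the projective resolutions. -/
abbrev projComplexMap {M M' : A} (a : M ⟶ M') : projComplex M ⟶ projComplex M' :=
  extendMap (ProjectiveResolution.lift a _ _) _

lemma projComplex_X_projective (M : A) (i : ℤ) : Projective ((projComplex M).X i) := by
  by_cases h : ∃ n, (ComplexShape.embeddingUpIntLE 0).f n = i
  · obtain ⟨n, h⟩ := h
    exact Projective.of_iso (extendXIso _ _ h).symm inferInstance
  · exact (isZero_extend_X _ _ _ (by simpa using h)).projective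

instance (M : A) : (projComplex M).IsKProjective := by
  have := projComplex_X_projective M
  have : (projComplex M).IsStrictlyLE 0 :=
    inferInstanceAs (((projectiveResolution M).complex.extend
      (ComplexShape.embeddingUpIntLE 0)).IsStrictlySupported (ComplexShape.embeddingUpIntLE 0))
  exact CochainComplex.isKProjective_of_projective _ 0

/-- The homology of the projective resolution in degree zero. -/
def projComplexHomologyIso (M : A) : (projComplex M).homology 0 ≅ M :=
  extendHomologyIso _ _ (j := 0) (by simp) ≪≫ isoOfQuasiIsoAt (projectiveResolution M).π 0 ≪≫
    singleObjHomologySelfIso _ _ _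

lemma projComplexHomologyIso_naturality {M M' : A} (a : M ⟶ M') :
    homologyMap (projComplexMap a) 0 ≫ (projComplexHomologyIso M').hom =
      (projComplexHomologyIso M).hom ≫ a := by
  have h := congrArg (fun f => homologyMap f 0) (ProjectiveResolution.lift_commutes a
    (projectiveResolution M) (projectiveResolution M'))
  simp only [homologyMap_comp] at h
  have h' : homologyMap ((ChainComplex.single₀ A).map a) 0 ≫
      (singleObjHomologySelfIso (ComplexShape.down ℕ) 0 M').hom =
      (singleObjHomologySelfIso (ComplexShape.down ℕ) 0 M).hom ≫ a :=
    singleObjHomologySelfIso_hom_naturality _ _ _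
  change _ ≫ _ ≫ homologyMap _ _ ≫ _ = (_ ≫ homologyMap _ _ ≫ _) ≫ a
  rw [projComplexMap, extendHomologyIso_hom_naturality_assoc, reassoc_of% h, h']
  simp only [Category.assoc]

lemma projComplex_exactOff (M : A) : (projComplex M).ExactOff 0 := by
  intro i hi
  by_cases h : ∃ n, (ComplexShape.embeddingUpIntLE 0).f n = i
  · obtain ⟨n, h⟩ := h
    rw [projComplex, extend_exactAt_iff _ _ h]
    obtain - | n := n
    · exact (hi (by simpa using h.symm)).elim
    · exact (projectiveResolution M).complex_exactAt_succ n
  · exact extend_exactAt _ _ _ (by simpa using h)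

/-- The left derived functors through the complex `projComplex M`. -/
def leftDerivedIso (M : A) {n : ℕ} {i : ℤ} (h : -(n : ℤ) = i) :
    ((F.mapHomologicalComplex _).obj (projComplex M)).homology i ≅ (F.leftDerived n).obj M :=
  mapExtendHomologyIso F (projectiveResolution M).complex (ComplexShape.embeddingUpIntLE 0)
    (by simpa using h) ≪≫ ((projectiveResolution M).isoLeftDerivedObj F n).symm

lemma leftDerivedIso_naturality {M M' : A} (a : M ⟶ M') {n : ℕ} {i : ℤ} (h : -(n : ℤ) = i) :
    homologyMap ((F.mapHomologicalComplex _).map (projComplexMap a)) i ≫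
        (leftDerivedIso F M' h).hom =
      (leftDerivedIso F M h).hom ≫ (F.leftDerived n).map a := by
  have h' := ProjectiveResolution.isoLeftDerivedObj_inv_naturality a (projectiveResolution M)
    (projectiveResolution M') (ProjectiveResolution.lift a _ _)
    (ProjectiveResolution.lift_commutes_zero _ _ _) F n
  change _ ≫ (mapExtendHomologyIso F _ _ _).hom ≫ _ = ((mapExtendHomologyIso F _ _ _).hom ≫ _) ≫ _
  refine (Category.assoc _ _ _).symm.trans ?_
  rw [projComplexMap, mapExtendHomologyIso_naturality]
  refine (Category.assoc _ _ _).trans (Eq.trans ?_ (Category.assoc _ _ _).symm)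
  exact congrArg (_ ≫ ·) h'.symm

lemma map_projComplex_exactAt {M : A} {i : ℤ}
    (h : ∀ n : ℕ, -(n : ℤ) = i → IsZero ((F.leftDerived n).obj M)) :
    ((F.mapHomologicalComplex _).obj (projComplex M)).ExactAt i := by
  by_cases h' : ∃ n, (ComplexShape.embeddingUpIntLE 0).f n = i
  · obtain ⟨n, h'⟩ := h'
    have h' : -(n : ℤ) = i := by simpa using h'
    rw [exactAt_iff_isZero_homology]
    exact (h n h').of_iso (leftDerivedIso F M h')
  · exact map_extend_exactAt F _ _ _ (by simpa using h')

end Projective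

section Injective

variable [HasInjectiveResolutions B] (G : B ⥤ A) [G.Additive]

/-- The injective resolution of `N`, as a cochain complex starting in degree `p`. -/
abbrev injComplex (p : ℤ) (N : B) : CochainComplex B ℤ :=
  (injectiveResolution N).cocomplex.extend (ComplexShape.embeddingUpIntGE p)

/-- An extension of `b : N ⟶ N'` to the injective resolutions. -/
abbrev injComplexMap (p : ℤ) {N N' : B} (b : N ⟶ N') : injComplex p N ⟶ injComplex p N' :=
  extendMap (InjectiveResolution.desc b _ _) _

variable (p : ℤ)

lemma injComplex_X_injective (N : B) (i : ℤ) : Injective ((injComplex p N).X i) := by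
  by_cases h : ∃ n, (ComplexShape.embeddingUpIntGE p).f n = i
  · obtain ⟨n, h⟩ := h
    exact Injective.of_iso (extendXIso _ _ h).symm inferInstance
  · exact (isZero_extend_X _ _ _ (by simpa using h)).injective

instance (N : B) : (injComplex p N).IsKInjective := by
  have := injComplex_X_injective p N
  have : (injComplex p N).IsStrictlyGE p :=
    inferInstanceAs (((injectiveResolution N).cocomplex.extend
      (ComplexShape.embeddingUpIntGE p)).IsStrictlySupported (ComplexShape.embeddingUpIntGE p))
  exact CochainComplex.isKInjective_of_injective _ p

/-- The homology of the injective resolution in the first degree. -/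
def injComplexHomologyIso (N : B) : (injComplex p N).homology p ≅ N :=
  extendHomologyIso _ _ (j := 0) (by simp) ≪≫
    (isoOfQuasiIsoAt (injectiveResolution N).ι 0).symm ≪≫ singleObjHomologySelfIso _ _ _

lemma injComplexHomologyIso_naturality {N N' : B} (b : N ⟶ N') :
    homologyMap (injComplexMap p b) p ≫ (injComplexHomologyIso p N').hom =
      (injComplexHomologyIso p N).hom ≫ b := by
  have h := congrArg (fun f => homologyMap f 0) (InjectiveResolution.desc_commutes b
    (injectiveResolution N') (injectiveResolution N))
  simp only [homologyMap_comp] at h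
  have h' : homologyMap ((CochainComplex.single₀ B).map b) 0 ≫
      (singleObjHomologySelfIso (ComplexShape.up ℕ) 0 N').hom =
      (singleObjHomologySelfIso (ComplexShape.up ℕ) 0 N).hom ≫ b :=
    singleObjHomologySelfIso_hom_naturality _ _ _
  have h'' : homologyMap (InjectiveResolution.desc b (injectiveResolution N')
      (injectiveResolution N)) 0 ≫ (isoOfQuasiIsoAt (injectiveResolution N').ι 0).inv =
      (isoOfQuasiIsoAt (injectiveResolution N).ι 0).inv ≫
        homologyMap ((CochainComplex.single₀ B).map b) 0 := by
    rw [Iso.comp_inv_eq, Category.assoc, Iso.eq_inv_comp]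
    exact h
  change _ ≫ _ ≫ _ ≫ _ = (_ ≫ _ ≫ _) ≫ b
  rw [injComplexMap, extendHomologyIso_hom_naturality_assoc]
  simp only [Category.assoc]
  rw [← h']
  exact congrArg (_ ≫ ·) ((Category.assoc _ _ _).symm.trans
    ((congrArg (· ≫ _) h'').trans (Category.assoc _ _ _)))

lemma injComplex_exactOff (N : B) : (injComplex p N).ExactOff p := by
  intro i hi
  by_cases h : ∃ n, (ComplexShape.embeddingUpIntGE p).f n = i
  · obtain ⟨n, h⟩ := h
    rw [injComplex, extend_exactAt_iff _ _ h]
    obtain - | n := n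
    · exact (hi (by simpa using h.symm)).elim
    · exact (injectiveResolution N).cocomplex_exactAt_succ n
  · exact extend_exactAt _ _ _ (by simpa using h)

/-- The right derived functors through the complex `injComplex p N`. -/
def rightDerivedIso (N : B) {n : ℕ} {i : ℤ} (h : p + n = i) :
    ((G.mapHomologicalComplex _).obj (injComplex p N)).homology i ≅ (G.rightDerived n).obj N :=
  mapExtendHomologyIso G (injectiveResolution N).cocomplex (ComplexShape.embeddingUpIntGE p)
    (by simpa using h) ≪≫ ((injectiveResolution N).isoRightDerivedObj G n).symm

lemma rightDerivedIso_naturality {N N' : B} (b : N ⟶ N') {n : ℕ} {i : ℤ} (h : p + n = i) :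
    homologyMap ((G.mapHomologicalComplex _).map (injComplexMap p b)) i ≫
        (rightDerivedIso G p N' h).hom =
      (rightDerivedIso G p N h).hom ≫ (G.rightDerived n).map b := by
  have h' := InjectiveResolution.isoRightDerivedObj_inv_naturality b (injectiveResolution N)
    (injectiveResolution N') (InjectiveResolution.desc b _ _)
    (InjectiveResolution.desc_commutes_zero _ _ _) G n
  change _ ≫ (mapExtendHomologyIso G _ _ _).hom ≫ _ = ((mapExtendHomologyIso G _ _ _).hom ≫ _) ≫ _
  refine (Category.assoc _ _ _).symm.trans ?_
  rw [injComplexMap, mapExtendHomologyIso_naturality]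
  refine (Category.assoc _ _ _).trans (Eq.trans ?_ (Category.assoc _ _ _).symm)
  exact congrArg (_ ≫ ·) h'.symm

lemma map_injComplex_exactAt {N : B} {i : ℤ}
    (h : ∀ n : ℕ, p + n = i → IsZero ((G.rightDerived n).obj N)) :
    ((G.mapHomologicalComplex _).obj (injComplex p N)).ExactAt i := by
  by_cases h' : ∃ n, (ComplexShape.embeddingUpIntGE p).f n = i
  · obtain ⟨n, h'⟩ := h'
    rw [exactAt_iff_isZero_homology]
    exact (h n h').of_iso (rightDerivedIso G p N h')
  · exact map_extend_exactAt G _ _ _ (by simpa using h')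

end Injective

end Resolutions

end CategoryTheory

end

/-! ### The correspondence of morphisms for derived adjoint functors -/

noncomputable section

namespace CategoryTheory

open Limits HomologicalComplex

variable {A B : Type*} [Category* A] [Category* B] [Abelian A] [Abelian B]
  {F : A ⥤ B} {G : B ⥤ A} [F.Additive] [G.Additive]

/-- The conditions under which an adjunction `F ⊣ G` derives to an equivalence: unit and counit are
isomorphisms on projective and on injective objects, and `F` and `G` preserve the acyclicity of
unbounded complexes with terms in classes `V` and `W` which contain the projectives and the images
of the injectives, the injectives and the images of the projectives, respectively. -/
structure DerivesToEquivalence (adj : F ⊣ G) (V : ObjectProperty A) (W : ObjectProperty B) :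
    Prop where
  isIso_unit (X : A) : Projective X → IsIso (adj.unit.app X)
  isIso_counit (Y : B) : Injective Y → IsIso (adj.counit.app Y)
  iso_left : V.IsClosedUnderIsomorphisms
  biprod_left (X Y : A) : V X → V Y → V (X ⊞ Y)
  projective_left (X : A) : Projective X → V X
  map_left (Y : B) : Injective Y → V (G.obj Y)
  acyclic_left (K : CochainComplex A ℤ) : K.Acyclic → (∀ i, V (K.X i)) →
    ((F.mapHomologicalComplex _).obj K).Acyclic
  iso_right : W.IsClosedUnderIsomorphisms
  biprod_right (X Y : B) : W X → W Y → W (X ⊞ Y)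
  injective_right (Y : B) : Injective Y → W Y
  map_right (X : A) : Projective X → W (F.obj X)
  acyclic_right (K : CochainComplex B ℤ) : K.Acyclic → (∀ i, W (K.X i)) →
    ((G.mapHomologicalComplex _).obj K).Acyclic

namespace DerivesToEquivalence

variable {adj : F ⊣ G} {V : ObjectProperty A} {W : ObjectProperty B}
  (hd : DerivesToEquivalence adj V W)

include hd

/-- The adjunct of f is the unit on K followed by G f. The unit is a termwise isomorphism because
the terms of K are projective, and G preserves the quasi-isomorphism f because its source and target
have terms in W. -/
lemma quasiIso_homEquiv {K : CochainComplex A ℤ} {L : CochainComplex B ℤ}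
    (hK : ∀ i, Projective (K.X i)) (hL : ∀ i, Injective (L.X i))
    (f : (F.mapHomologicalComplex _).obj K ⟶ L) (hf : QuasiIso f) :
    QuasiIso ((adj.mapComplex _).homEquiv K L f) := by
  have := hd.iso_right
  have := CochainComplex.quasiIso_map_of_acyclic G W hd.biprod_right hd.acyclic_right
    (fun i => hd.map_right _ (hK i)) (fun i => hd.injective_right _ (hL i)) f hf
  have := adj.isIso_mapComplex_unit_app _ K fun i => hd.isIso_unit _ (hK i)
  rw [Adjunction.homEquiv_unit]
  infer_instance

lemma quasiIso_homEquiv_symm {K : CochainComplex A ℤ} {L : CochainComplex B ℤ}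
    (hK : ∀ i, Projective (K.X i)) (hL : ∀ i, Injective (L.X i))
    (f : K ⟶ (G.mapHomologicalComplex _).obj L) (hf : QuasiIso f) :
    QuasiIso (((adj.mapComplex _).homEquiv K L).symm f) := by
  have := hd.iso_left
  have := CochainComplex.quasiIso_map_of_acyclic F V hd.biprod_left hd.acyclic_left
    (fun i => hd.projective_left _ (hK i)) (fun i => hd.map_left _ (hL i)) f hf
  have := adj.isIso_mapComplex_counit_app _ L fun i => hd.isIso_counit _ (hL i)
  rw [Adjunction.homEquiv_counit]
  infer_instance

section

variable [HasProjectiveResolutions A]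

/-- An object on which all left derived functors vanish is zero. -/
lemma isZero_of_leftDerived {M : A} (h : ∀ n : ℕ, IsZero ((F.leftDerived n).obj M)) :
    IsZero M := by
  have h1 : ((F.mapHomologicalComplex _).obj (projComplex M)).Acyclic :=
    fun i => map_projComplex_exactAt F fun n _ => h n
  -- F of the resolution is acyclic with terms in W, so applying G keeps it acyclic, and the unit
  -- identifies the result with the resolution itself.
  have h2 := hd.acyclic_right _ h1 fun i => hd.map_right _ (projComplex_X_projective M i)
  have := adj.isIso_mapComplex_unit_app _ (projComplex M)
    fun i => hd.isIso_unit _ (projComplex_X_projective M i)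
  have h3 : (projComplex M).ExactAt 0 :=
    (h2 0).of_iso (asIso ((adj.mapComplex _).unit.app (projComplex M))).symm
  exact ((exactAt_iff_isZero_homology _ _).1 h3).of_iso (projComplexHomologyIso M).symm

end

section

variable [HasInjectiveResolutions B]

/-- An object on which all right derived functors vanish is zero. -/
lemma isZero_of_rightDerived {N : B} (h : ∀ n : ℕ, IsZero ((G.rightDerived n).obj N)) :
    IsZero N := by
  have h1 : ((G.mapHomologicalComplex _).obj (injComplex 0 N)).Acyclic :=
    fun i => map_injComplex_exactAt G 0 fun n _ => h n
  have h2 := hd.acyclic_left _ h1 fun i => hd.map_left _ (injComplex_X_injective 0 N i)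
  have := adj.isIso_mapComplex_counit_app _ (injComplex 0 N)
    fun i => hd.isIso_counit _ (injComplex_X_injective 0 N i)
  have h3 : (injComplex 0 N).ExactAt 0 :=
    (h2 0).of_iso (asIso ((adj.mapComplex _).counit.app (injComplex 0 N)))
  exact ((exactAt_iff_isZero_homology _ _).1 h3).of_iso (injComplexHomologyIso 0 N).symm

end

end DerivesToEquivalence

variable [HasProjectiveResolutions A] [HasInjectiveResolutions B] (adj : F ⊣ G)

/-- Two morphisms `L_ℓ F M ⟶ N` and `M ⟶ R^ℓ G N` correspond to each other if they are induced by
adjoint morphisms of complexes between resolutions of `M` and `N`. -/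
def derivedRel (ℓ : ℕ) ⦃M : A⦄ ⦃N : B⦄ (h : (F.leftDerived ℓ).obj M ⟶ N)
    (g : M ⟶ (G.rightDerived ℓ).obj N) : Prop :=
  ∃ f : (F.mapHomologicalComplex _).obj (projComplex M) ⟶ injComplex (-ℓ) N,
    homologyMap f (-ℓ) ≫ (injComplexHomologyIso (-ℓ) N).hom = (leftDerivedIso F M rfl).hom ≫ h ∧
    homologyMap ((adj.mapComplex _).homEquiv _ _ f) 0 ≫
      (rightDerivedIso G (-ℓ) N (neg_add_cancel _)).hom = (projComplexHomologyIso M).hom ≫ g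

variable {adj} {ℓ : ℕ}

lemma derivedRel.comp_left {M M' : A} {N : B} (a : M' ⟶ M) {h : (F.leftDerived ℓ).obj M ⟶ N}
    {g : M ⟶ (G.rightDerived ℓ).obj N} (H : derivedRel adj ℓ h g) :
    derivedRel adj ℓ ((F.leftDerived ℓ).map a ≫ h) (a ≫ g) := by
  obtain ⟨f, h1, h2⟩ := H
  refine ⟨(F.mapHomologicalComplex _).map (projComplexMap a) ≫ f, ?_, ?_⟩
  · rw [homologyMap_comp, Category.assoc, h1, ← Category.assoc, leftDerivedIso_naturality,
      Category.assoc]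
  · rw [Adjunction.homEquiv_naturality_left, homologyMap_comp, Category.assoc, h2,
      ← Category.assoc, projComplexHomologyIso_naturality, Category.assoc]

lemma derivedRel.comp_right {M : A} {N N' : B} (b : N ⟶ N') {h : (F.leftDerived ℓ).obj M ⟶ N}
    {g : M ⟶ (G.rightDerived ℓ).obj N} (H : derivedRel adj ℓ h g) :
    derivedRel adj ℓ (h ≫ b) (g ≫ (G.rightDerived ℓ).map b) := by
  obtain ⟨f, h1, h2⟩ := H
  refine ⟨f ≫ injComplexMap _ b, ?_, ?_⟩
  · rw [homologyMap_comp, Category.assoc, injComplexHomologyIso_naturality, ← Category.assoc, h1,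
      Category.assoc]
  · rw [Adjunction.homEquiv_naturality_right, homologyMap_comp, Category.assoc,
      rightDerivedIso_naturality, ← Category.assoc, h2, Category.assoc]

variable {M : A} {N : B}

lemma map_projComplex_exactOff (hM : ∀ n : ℕ, n ≠ ℓ → IsZero ((F.leftDerived n).obj M)) :
    CochainComplex.ExactOff ((F.mapHomologicalComplex _).obj (projComplex M)) (-ℓ) :=
  fun i hi => map_projComplex_exactAt F fun n hn => hM n (by rintro rfl; exact hi hn.symm)

lemma map_injComplex_exactOff (hN : ∀ n : ℕ, n ≠ ℓ → IsZero ((G.rightDerived n).obj N)) :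
    CochainComplex.ExactOff ((G.mapHomologicalComplex _).obj (injComplex (-ℓ) N)) 0 :=
  fun i hi => map_injComplex_exactAt G _ fun n hn => hN n (by rintro rfl; omega)

/-- Both complexes have homology only in degree -ℓ and the target is K-injective, so h is realised
by a chain map; g is read off from the adjunct. -/
lemma derivedRel_exists_right (hM : ∀ n : ℕ, n ≠ ℓ → IsZero ((F.leftDerived n).obj M))
    (h : (F.leftDerived ℓ).obj M ⟶ N) : ∃ g, derivedRel adj ℓ h g := by
  obtain ⟨f, hf⟩ := (CochainComplex.homotopy_classes_of_isKInjective
    (map_projComplex_exactOff hM) (injComplex_exactOff (-ℓ) N)).1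
      ((leftDerivedIso F M rfl).hom ≫ h ≫ (injComplexHomologyIso (-ℓ) N).inv)
  refine ⟨(projComplexHomologyIso M).inv ≫ homologyMap ((adj.mapComplex _).homEquiv _ _ f) 0 ≫
      (rightDerivedIso G (-ℓ) N (neg_add_cancel _)).hom, f, ?_, ?_⟩
  · rw [hf]
    simp
  · simp

lemma derivedRel_exists_left (hN : ∀ n : ℕ, n ≠ ℓ → IsZero ((G.rightDerived n).obj N))
    (g : M ⟶ (G.rightDerived ℓ).obj N) : ∃ h, derivedRel adj ℓ h g := by
  obtain ⟨f, hf⟩ := (CochainComplex.homotopy_classes_of_isKProjective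
    (projComplex_exactOff M) (map_injComplex_exactOff hN)).1
      ((projComplexHomologyIso M).hom ≫ g ≫ (rightDerivedIso G (-ℓ) N (neg_add_cancel _)).inv)
  refine ⟨(leftDerivedIso F M rfl).inv ≫
    homologyMap (((adj.mapComplex _).homEquiv _ _).symm f) (-ℓ) ≫
      (injComplexHomologyIso (-ℓ) N).hom, ((adj.mapComplex _).homEquiv _ _).symm f, ?_, ?_⟩
  · simp
  · rw [Equiv.apply_symm_apply, hf]
    simp

/-- Two chain maps that realise h are homotopic, and passing to adjuncts preserves homotopies. -/
lemma derivedRel_unique_right (hM : ∀ n : ℕ, n ≠ ℓ → IsZero ((F.leftDerived n).obj M))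
    {h : (F.leftDerived ℓ).obj M ⟶ N} {g g' : M ⟶ (G.rightDerived ℓ).obj N}
    (H : derivedRel adj ℓ h g) (H' : derivedRel adj ℓ h g') : g = g' := by
  obtain ⟨f, h1, h2⟩ := H
  obtain ⟨f', h1', h2'⟩ := H'
  have hf : homologyMap f (-ℓ) = homologyMap f' (-ℓ) := by
    rw [← cancel_mono (injComplexHomologyIso (-ℓ) N).hom, h1, h1']
  obtain ⟨e⟩ := adj.homotopy_homEquiv _ ((CochainComplex.homotopy_classes_of_isKInjective
    (map_projComplex_exactOff hM) (injComplex_exactOff (-ℓ) N)).2 f f' hf)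
  rw [← cancel_epi (projComplexHomologyIso M).hom, ← h2, ← h2', e.homologyMap_eq]

lemma derivedRel_unique_left (hN : ∀ n : ℕ, n ≠ ℓ → IsZero ((G.rightDerived n).obj N))
    {h h' : (F.leftDerived ℓ).obj M ⟶ N} {g : M ⟶ (G.rightDerived ℓ).obj N}
    (H : derivedRel adj ℓ h g) (H' : derivedRel adj ℓ h' g) : h = h' := by
  obtain ⟨f, h1, h2⟩ := H
  obtain ⟨f', h1', h2'⟩ := H'
  have hf : homologyMap ((adj.mapComplex _).homEquiv _ _ f) 0 =
      homologyMap ((adj.mapComplex _).homEquiv _ _ f') 0 := by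
    rw [← cancel_mono (rightDerivedIso G (-ℓ) N (neg_add_cancel _)).hom, h2, h2']
  obtain ⟨e⟩ := adj.homotopy_homEquiv_symm _ ((CochainComplex.homotopy_classes_of_isKProjective
    (projComplex_exactOff M) (map_injComplex_exactOff hN)).2 _ _ hf)
  rw [Equiv.symm_apply_apply, Equiv.symm_apply_apply] at e
  rw [← cancel_epi (leftDerivedIso F M rfl).hom, ← h1, ← h1', e.homologyMap_eq]

variable {V : ObjectProperty A} {W : ObjectProperty B}

namespace DerivesToEquivalence

variable (hd : DerivesToEquivalence adj V W)
include hd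

/-- An isomorphism `L_ℓ F M ≅ N` corresponds to an isomorphism `M ≅ R^ℓ G N`, and `R^i G N`
vanishes for `i ≠ ℓ`. -/
lemma isIso_right (hM : ∀ n : ℕ, n ≠ ℓ → IsZero ((F.leftDerived n).obj M))
    {h : (F.leftDerived ℓ).obj M ⟶ N} {g : M ⟶ (G.rightDerived ℓ).obj N}
    (H : derivedRel adj ℓ h g) (hh : IsIso h) :
    IsIso g ∧ ∀ n : ℕ, n ≠ ℓ → IsZero ((G.rightDerived n).obj N) := by
  obtain ⟨f, h1, h2⟩ := H
  have : IsIso (homologyMap f (-ℓ)) := by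
    rw [← Iso.eq_comp_inv] at h1
    rw [h1]
    infer_instance
  -- The map f is an isomorphism on the only homology present, hence a quasi-isomorphism. So is its
  -- adjunct, which therefore identifies RⁿG N with the homology of the projective resolution in
  -- degree n - ℓ.
  have hf := hd.quasiIso_homEquiv (projComplex_X_projective M) (injComplex_X_injective (-ℓ) N) f
    (CochainComplex.quasiIso_of_exactOff (map_projComplex_exactOff hM)
      (injComplex_exactOff (-ℓ) N) f)
  constructor
  · rw [← Iso.inv_comp_eq] at h2
    rw [← h2]
    infer_instance
  · intro n hn
    have hz := (exactAt_iff_isZero_homology _ _).1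
      (projComplex_exactOff M (-ℓ + n) (by omega))
    exact hz.of_iso ((rightDerivedIso G (-ℓ) N rfl).symm ≪≫
      (isoOfQuasiIsoAt ((adj.mapComplex _).homEquiv _ _ f) (-ℓ + n)).symm)

/-- An isomorphism `M ≅ R^ℓ G N` corresponds to an isomorphism `L_ℓ F M ≅ N`, and `L_i F M`
vanishes for `i ≠ ℓ`. -/
lemma isIso_left (hN : ∀ n : ℕ, n ≠ ℓ → IsZero ((G.rightDerived n).obj N))
    {h : (F.leftDerived ℓ).obj M ⟶ N} {g : M ⟶ (G.rightDerived ℓ).obj N}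
    (H : derivedRel adj ℓ h g) (hg : IsIso g) :
    IsIso h ∧ ∀ n : ℕ, n ≠ ℓ → IsZero ((F.leftDerived n).obj M) := by
  obtain ⟨f, h1, h2⟩ := H
  have : IsIso (homologyMap ((adj.mapComplex _).homEquiv _ _ f) 0) := by
    rw [← Iso.eq_comp_inv] at h2
    rw [h2]
    infer_instance
  have hf := hd.quasiIso_homEquiv_symm (projComplex_X_projective M)
    (injComplex_X_injective (-ℓ) N) _
    (CochainComplex.quasiIso_of_exactOff (projComplex_exactOff M)
      (map_injComplex_exactOff hN) ((adj.mapComplex _).homEquiv _ _ f))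
  rw [Equiv.symm_apply_apply] at hf
  constructor
  · rw [← Iso.inv_comp_eq] at h1
    rw [← h1]
    infer_instance
  · intro n hn
    have hz := (exactAt_iff_isZero_homology _ _).1
      (injComplex_exactOff (-ℓ) N (-n) (by omega))
    exact hz.of_iso ((leftDerivedIso F M rfl).symm ≪≫ isoOfQuasiIsoAt f (-n))

/-- The derived functors `L_ℓ F` and `R^ℓ G` restrict to an adjoint equivalence between classes of
objects concentrated in degree `ℓ`. -/
lemma restrictsToAdjointEquivalence (P : ObjectProperty A) (Q : ObjectProperty B)
    (hP : ∀ M, P M → ∀ n : ℕ, n ≠ ℓ → IsZero ((F.leftDerived n).obj M))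
    (hQ : ∀ N, Q N → ∀ n : ℕ, n ≠ ℓ → IsZero ((G.rightDerived n).obj N))
    (hF : ∀ M, P M → (∀ n : ℕ, n ≠ ℓ →
      IsZero ((G.rightDerived n).obj ((F.leftDerived ℓ).obj M))) → Q ((F.leftDerived ℓ).obj M))
    (hG : ∀ N, Q N → (∀ n : ℕ, n ≠ ℓ →
      IsZero ((F.leftDerived n).obj ((G.rightDerived ℓ).obj N))) → P ((G.rightDerived ℓ).obj N)) :
    Bimod.RestrictsToAdjointEquivalence (F.leftDerived ℓ) (G.rightDerived ℓ) P Q := by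
  refine Bimod.restrictsToAdjointEquivalence_of_rel _ _ P Q (derivedRel adj ℓ)
    (fun _ _ _ a _ _ H => H.comp_left a) (fun _ _ _ b _ _ H => H.comp_right b)
    (fun _ _ hX => derivedRel_exists_right (hP _ hX))
    (fun _ _ hX _ _ _ => derivedRel_unique_right (hP _ hX))
    (fun _ _ hY => derivedRel_exists_left (hQ _ hY))
    (fun _ _ hY _ _ _ => derivedRel_unique_left (hQ _ hY)) (fun M hM => ?_) (fun N hN => ?_)
    (fun M hM g H => (hd.isIso_right (hP M hM) H inferInstance).1)
    (fun N hN h H => (hd.isIso_left (hQ N hN) H inferInstance).1)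
  -- The partner of the identity exists, and the identity being invertible already forces the
  -- vanishing on the other side.
  · obtain ⟨g, H⟩ := derivedRel_exists_right (adj := adj) (hP M hM) (𝟙 _)
    exact hF M hM (hd.isIso_right (hP M hM) H inferInstance).2
  · obtain ⟨h, H⟩ := derivedRel_exists_left (adj := adj) (hQ N hN) (𝟙 _)
    exact hG N hN (hd.isIso_left (hQ N hN) H inferInstance).2

end DerivesToEquivalence

end CategoryTheory

end

noncomputable section

/-! ### Vanishing of `Ext` and short exact sequences -/

namespace CategoryTheory.ShortComplex.ShortExact

open Abelian

universe w v v'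
variable {C : Type v} [Category.{v'} C] [Abelian C] [HasExt.{w} C] {S : ShortComplex C}
  (hS : S.ShortExact)

include hS

lemma exists_extension {Y : C} (h : Subsingleton (Ext.{w} S.X₃ Y 1)) (f : S.X₁ ⟶ Y) :
    ∃ g : S.X₂ ⟶ Y, S.f ≫ g = f := by
  obtain ⟨x, hx⟩ := Ext.contravariant_sequence_exact₁ hS Y (Ext.mk₀ f) (n₁ := 1) rfl
    (Subsingleton.elim _ _)
  obtain ⟨g, rfl⟩ := Ext.mk₀_bijective _ _ |>.2 x
  refine ⟨g, (Ext.mk₀_bijective _ _).1 ?_⟩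
  rw [← hx, Ext.mk₀_comp_mk₀]

lemma subsingleton_ext_one {Y : C} [Projective S.X₂]
    (h : ∀ f : S.X₁ ⟶ Y, ∃ g : S.X₂ ⟶ Y, S.f ≫ g = f) : Subsingleton (Ext.{w} S.X₃ Y 1) := by
  refine subsingleton_of_forall_eq 0 fun x => ?_
  obtain ⟨y, rfl⟩ := Ext.contravariant_sequence_exact₃ hS Y x (Ext.eq_zero_of_projective _)
    (n₀ := 0) rfl
  obtain ⟨f, rfl⟩ := Ext.mk₀_bijective _ _ |>.2 y
  obtain ⟨g, rfl⟩ := h f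
  rw [← Ext.mk₀_comp_mk₀, hS.extClass_comp_assoc]

lemma subsingleton_ext_succ {Y : C} [Projective S.X₂] {n : ℕ}
    (h : Subsingleton (Ext.{w} S.X₁ Y n)) : Subsingleton (Ext.{w} S.X₃ Y (n + 1)) := by
  refine subsingleton_of_forall_eq 0 fun x => ?_
  obtain ⟨y, rfl⟩ := Ext.contravariant_sequence_exact₃ hS Y x (Ext.eq_zero_of_projective _)
    (n₀ := n) (add_comm _ _)
  rw [Subsingleton.elim y 0, Ext.comp_zero]

lemma subsingleton_ext_pred {Y : C} [Projective S.X₂] {n : ℕ}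
    (h : Subsingleton (Ext.{w} S.X₃ Y (n + 2))) : Subsingleton (Ext.{w} S.X₁ Y (n + 1)) := by
  refine subsingleton_of_forall_eq 0 fun x => ?_
  obtain ⟨y, rfl⟩ := Ext.contravariant_sequence_exact₁ hS Y x (n₁ := n + 2) (by omega)
    (Subsingleton.elim _ _)
  rw [Ext.eq_zero_of_projective y, Ext.comp_zero]

lemma exists_lift {X : C} (h : Subsingleton (Ext.{w} X S.X₁ 1)) (f : X ⟶ S.X₃) :
    ∃ g : X ⟶ S.X₂, g ≫ S.g = f := by
  obtain ⟨x, hx⟩ := Ext.covariant_sequence_exact₃ X hS (Ext.mk₀ f) (n₁ := 1) rfl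
    (Subsingleton.elim _ _)
  obtain ⟨g, rfl⟩ := Ext.mk₀_bijective _ _ |>.2 x
  refine ⟨g, (Ext.mk₀_bijective _ _).1 ?_⟩
  rw [← hx, Ext.mk₀_comp_mk₀]

lemma subsingleton_ext_right {X : C} {n : ℕ} (h : Subsingleton (Ext.{w} X S.X₁ (n + 1)))
    (h' : Subsingleton (Ext.{w} X S.X₂ n)) : Subsingleton (Ext.{w} X S.X₃ n) := by
  refine subsingleton_of_forall_eq 0 fun x => ?_
  obtain ⟨y, rfl⟩ := Ext.covariant_sequence_exact₃ X hS x (n₁ := n + 1) rfl (Subsingleton.elim _ _)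
  rw [Subsingleton.elim y 0, Ext.zero_comp]

end CategoryTheory.ShortComplex.ShortExact

/-! ### Acyclic complexes and `Hom` out of an object of finite projective dimension -/

namespace CochainComplex

open Abelian

universe w v v'
variable {C : Type v} [Category.{v'} C] [Abelian C]

/-- The sequence `0 ⟶ Zⁿ ⟶ Kⁿ ⟶ Zⁿ⁺¹ ⟶ 0` of an acyclic complex. -/
lemma shortExact_cycles {K : CochainComplex C ℤ} (hK : K.Acyclic) (n : ℤ) :
    (ShortComplex.mk (K.iCycles n) (K.toCycles n (n + 1))
      (by simp [← cancel_mono (K.iCycles (n + 1))])).ShortExact := by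
  have : Epi (K.toCycles n (n + 1)) :=
    Preadditive.epi_of_isZero_cokernel' _ (K.homologyIsCokernel n (n + 1) (by simp))
      ((HomologicalComplex.exactAt_iff_isZero_homology _ _).1 (hK (n + 1)))
  let S := ShortComplex.mk (K.iCycles n) (K.toCycles n (n + 1))
    (by simp [← cancel_mono (K.iCycles (n + 1))])
  let S' := ShortComplex.mk (K.iCycles n) (K.d n (n + 1)) (by simp)
  let φ : S ⟶ S' := { τ₁ := 𝟙 _, τ₂ := 𝟙 _, τ₃ := K.iCycles (n + 1) }
  have : Epi φ.τ₁ := inferInstanceAs (Epi (𝟙 _))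
  have : IsIso φ.τ₂ := inferInstanceAs (IsIso (𝟙 _))
  have : Mono φ.τ₃ := inferInstanceAs (Mono (K.iCycles (n + 1)))
  have hS' : S'.Exact := S'.exact_of_f_is_kernel (K.cyclesIsKernel n (n + 1) (by simp))
  exact
    { exact := (ShortComplex.exact_iff_of_epi_of_isIso_of_mono φ).2 hS'
      mono_f := inferInstanceAs (Mono (K.iCycles n))
      epi_g := inferInstanceAs (Epi (K.toCycles n (n + 1))) }

variable [HasExt.{w} C]

/-- Morphisms out of an object `T` of finite projective dimension preserve the exactness of complexes
whose terms have no higher extensions by `T`. -/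
lemma exists_lift_of_acyclic {T : C} {d : ℕ} [HasProjectiveDimensionLT T d]
    {K : CochainComplex C ℤ} (hK : K.Acyclic)
    (hT : ∀ n : ℤ, ∀ i : ℕ, 0 < i → Subsingleton (Ext.{w} T (K.X n) i)) {m n : ℤ} (hmn : m + 1 = n)
    (f : T ⟶ K.X n) (hf : f ≫ K.d n (n + 1) = 0) : ∃ g : T ⟶ K.X m, g ≫ K.d m n = f := by
  -- Dimension shifting along 0 ⟶ Zⁿ ⟶ Kⁿ ⟶ Zⁿ⁺¹ ⟶ 0: vanishing of Extⁱ⁺¹(T, Zⁿ) and Extⁱ(T, Kⁿ)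
  -- gives that of Extⁱ(T, Zⁿ⁺¹). It starts from i ≥ d, so no boundedness of K is needed.
  have key (e : ℕ) : ∀ i : ℕ, d ≤ i + e → 0 < i → ∀ n : ℤ,
      Subsingleton (Ext.{w} T (K.cycles n) i) := by
    induction e with
    | zero => exact fun i hi _ n => HasProjectiveDimensionLT.subsingleton T d i hi _
    | succ e ih =>
      intro i hi h0 n
      obtain ⟨n, rfl⟩ : ∃ n', n = n' + 1 := ⟨n - 1, by omega⟩
      exact (shortExact_cycles hK n).subsingleton_ext_right (ih (i + 1) (by omega) (by omega) n)
        (hT n i h0)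
  subst hmn
  -- The map f lands in the cycles and lifts through Kᵐ because Ext¹(T, Zᵐ) = 0.
  obtain ⟨g, hg⟩ := (shortExact_cycles hK m).exists_lift (key d 1 (by omega) one_pos m)
    (K.liftCycles f _ (by simp) hf)
  refine ⟨g, ?_⟩
  have := congrArg (· ≫ K.iCycles _) hg
  simpa using this

end CochainComplex

/-! ### Modules with a resolution by finitely generated projectives -/

namespace Bimod

open Abelian

variable {R : Type u} [Ring R]

/-- A module with a sequence of syzygies in finitely generated projective modules. -/
def HasFGSyzygies (M : ModuleCat.{u} R) : Prop :=
  ∃ S : ℕ → ModuleCat.{u} R, Nonempty (S 0 ≅ M) ∧ ∀ n, ∃ (Q : ModuleCat.{u} R) (f : S (n + 1) ⟶ Q)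
    (g : Q ⟶ S n) (w : f ≫ g = 0), (ShortComplex.mk f g w).ShortExact ∧ Module.Finite R Q ∧
      Projective Q

lemma HasFGSyzygies.exists_syzygy {M : ModuleCat.{u} R} (h : HasFGSyzygies M) :
    ∃ (S Q : ModuleCat.{u} R) (f : S ⟶ Q) (g : Q ⟶ M) (w : f ≫ g = 0), HasFGSyzygies S ∧
      (ShortComplex.mk f g w).ShortExact ∧ Module.Finite R Q ∧ Projective Q := by
  obtain ⟨S, ⟨e⟩, h⟩ := h
  obtain ⟨Q, f, g, w, hE, hQ, hQ'⟩ := h 0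
  refine ⟨S 1, Q, f, g ≫ e.hom, by rw [reassoc_of% w, Limits.zero_comp],
    ⟨fun n => S (n + 1), ⟨Iso.refl _⟩, fun n => h (n + 1)⟩, ?_, hQ, hQ'⟩
  exact ShortComplex.shortExact_of_iso (S₁ := ShortComplex.mk f g w)
    (ShortComplex.isoMk (Iso.refl _) (Iso.refl _) e (by simp) (by simp)) hE

lemma HasFGSyzygies.finite {M : ModuleCat.{u} R} (h : HasFGSyzygies M) : Module.Finite R M := by
  obtain ⟨S, Q, f, g, w, -, hE, hQ, -⟩ := h.exists_syzygy
  exact Module.Finite.of_surjective g.hom hE.moduleCat_surjective_g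

/-- The syzygies are the cokernels of the differentials. In degree zero this is M, and exactness in
positive degrees embeds each later one in the preceding term of the resolution. -/
lemma HasFGProjectiveResolution.hasFGSyzygies {M : Type u} [AddCommGroup M] [Module R M]
    (h : HasFGProjectiveResolution R M) : HasFGSyzygies (ModuleCat.of R M) := by
  obtain ⟨P, hP⟩ := h
  have hw (n : ℕ) : P.complex.fromOpcycles (n + 1) n ≫ P.complex.pOpcycles n = 0 := by
    simp [← cancel_epi (P.complex.pOpcycles (n + 1))]
  refine ⟨fun n => P.complex.opcycles n, ?_, fun n => ⟨P.complex.X n,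
    P.complex.fromOpcycles (n + 1) n, P.complex.pOpcycles n, hw n, ?_, hP n, inferInstance⟩⟩
  · exact ⟨((P.complex.opcyclesIsCokernel 1 0 (by simp)).coconePointUniqueUpToIso
      P.isColimitCokernelCofork)⟩
  · have : Mono (P.complex.fromOpcycles (n + 1) n) :=
      Preadditive.mono_of_isZero_kernel' _ (P.complex.homologyIsKernel (n + 1) n (by simp))
        ((HomologicalComplex.exactAt_iff_isZero_homology _ _).1 (P.complex_exactAt_succ n))
    let S := ShortComplex.mk _ _ (hw n)
    let S' := ShortComplex.mk (P.complex.d (n + 1) n) (P.complex.pOpcycles n) (by simp)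
    let φ : S' ⟶ S := { τ₁ := P.complex.pOpcycles (n + 1), τ₂ := 𝟙 _, τ₃ := 𝟙 _ }
    have : Epi φ.τ₁ := inferInstanceAs (Epi (P.complex.pOpcycles (n + 1)))
    have : IsIso φ.τ₂ := inferInstanceAs (IsIso (𝟙 _))
    have : Mono φ.τ₃ := inferInstanceAs (Mono (𝟙 _))
    have hS' : S'.Exact :=
      S'.exact_of_g_is_cokernel (P.complex.opcyclesIsCokernel (n + 1) n (by simp))
    exact
      { exact := (ShortComplex.exact_iff_of_epi_of_isIso_of_mono φ).1 hS'
        mono_f := inferInstanceAs (Mono (P.complex.fromOpcycles (n + 1) n))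
        epi_g := inferInstanceAs (Epi (P.complex.pOpcycles n)) }

lemma exists_finset_support_subset {S N : Type*} [AddCommGroup S] [Module R S] [Module.Finite R S]
    [AddCommGroup N] [Module R N] {X : Type*} (f : S →ₗ[R] X →₀ N) :
    ∃ s : Finset X, ∀ y, (f y).support ⊆ s := by
  classical
  obtain ⟨t, ht⟩ := Module.Finite.fg_top (R := R) (M := S)
  refine ⟨t.biUnion fun y => (f y).support, fun y => ?_⟩
  have hy : y ∈ Submodule.span R (t : Set S) := ht ▸ Submodule.mem_top
  induction hy using Submodule.span_induction with
  | mem y hy => exact Finset.subset_biUnion_of_mem (fun y => (f y).support) hy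
  | zero => simp
  | add a b _ _ ha hb =>
    rw [map_add]
    exact Finsupp.support_add.trans (Finset.union_subset ha hb)
  | smul r a _ ha =>
    rw [map_smul]
    exact Finsupp.support_smul.trans ha

/-- If `S` is finitely generated and maps `S → N` extend along `i : S → Q`, then so do maps from `S`
to direct sums of copies of `N`. -/
lemma exists_extension_finsupp {S Q N : Type*} [AddCommGroup S] [Module R S] [Module.Finite R S]
    [AddCommGroup Q] [Module R Q] [AddCommGroup N] [Module R N] (i : S →ₗ[R] Q)
    (h : ∀ f : S →ₗ[R] N, ∃ g : Q →ₗ[R] N, g ∘ₗ i = f) {X : Type*} (f : S →ₗ[R] X →₀ N) :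
    ∃ g : Q →ₗ[R] X →₀ N, g ∘ₗ i = f := by
  classical
  obtain ⟨s, hs⟩ := exists_finset_support_subset f
  choose g hg using fun x => h (Finsupp.lapply x ∘ₗ f)
  refine ⟨∑ x ∈ s, Finsupp.lsingle x ∘ₗ g x, LinearMap.ext fun y => ?_⟩
  have hg' (x : X) : g x (i y) = f y x := LinearMap.congr_fun (hg x) y
  simp only [LinearMap.comp_apply, LinearMap.sum_apply, hg', Finsupp.lsingle_apply]
  exact (Finsupp.sum_of_support_subset (f y) (hs y) _ (by simp)).symm.trans (Finsupp.sum_single _)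

/-- Vanishing of `Ext` out of a module with finitely generated syzygies passes to direct sums. -/
lemma HasFGSyzygies.subsingleton_ext_finsupp {N : Type u} [AddCommGroup N] [Module R N] (X : Type u)
    (i : ℕ) : ∀ {M : ModuleCat.{u} R}, HasFGSyzygies M →
      (∀ j : ℕ, 0 < j → Subsingleton (Ext.{u} M (ModuleCat.of R N) j)) →
      Subsingleton (Ext.{u} M (ModuleCat.of R (X →₀ N)) (i + 1)) := by
  induction i with
  | zero =>
    intro M hM h
    obtain ⟨S, Q, f, g, w, hS, hE, hQ, hQ'⟩ := hM.exists_syzygy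
    have := hS.finite
    -- As Q is projective, vanishing of Ext¹ means that maps extend from S to Q. This passes to
    -- direct sums because S is finitely generated.
    refine hE.subsingleton_ext_one fun φ => ?_
    obtain ⟨ψ, hψ⟩ := exists_extension_finsupp (N := N) f.hom (fun φ => by
      obtain ⟨ψ, hψ⟩ := hE.exists_extension (h 1 one_pos) (ModuleCat.ofHom φ)
      exact ⟨ψ.hom, congrArg ModuleCat.Hom.hom hψ⟩) φ.hom
    exact ⟨ModuleCat.ofHom ψ, ModuleCat.hom_ext hψ⟩
  | succ i ih =>
    intro M hM h
    obtain ⟨S, Q, f, g, w, hS, hE, hQ, hQ'⟩ := hM.exists_syzygy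
    refine hE.subsingleton_ext_succ (ih hS fun j hj => ?_)
    obtain ⟨j, rfl⟩ : ∃ j', j = j' + 1 := ⟨j - 1, by omega⟩
    exact hE.subsingleton_ext_pred (h (j + 2) (by omega))

end Bimod

end

noncomputable section

/-! ### Objects without higher extensions -/

namespace CategoryTheory.Abelian.Ext

universe w v v'
variable {C : Type v} [Category.{v'} C] [Abelian C] [HasExt.{w} C]

lemma subsingleton_of_retract {T X Y : C} {n : ℕ} (i : X ⟶ Y) (r : Y ⟶ X) (h : i ≫ r = 𝟙 X)
    (hY : Subsingleton (Ext.{w} T Y n)) : Subsingleton (Ext.{w} T X n) := by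
  refine subsingleton_of_forall_eq 0 fun x => ?_
  have h1 : (x.comp (mk₀ i) (add_zero n)).comp (mk₀ r) (add_zero n) = x := by
    rw [comp_assoc_of_third_deg_zero, mk₀_comp_mk₀, h, comp_mk₀_id]
  rw [← h1, Subsingleton.elim (x.comp (mk₀ i) (add_zero n)) 0, zero_comp]

/-- The objects `X` with `Ext^i(T, X) = 0` for all `i > 0`. -/
def rightAcyclic (T : C) : ObjectProperty C := fun X => ∀ i : ℕ, 0 < i → Subsingleton (Ext.{w} T X i)

lemma rightAcyclic_of_retract {T X Y : C} (i : X ⟶ Y) (r : Y ⟶ X) (h : i ≫ r = 𝟙 X)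
    (hY : rightAcyclic.{w} T Y) : rightAcyclic.{w} T X :=
  fun n hn => subsingleton_of_retract i r h (hY n hn)

lemma rightAcyclic_biprod {T X Y : C} (hX : rightAcyclic.{w} T X) (hY : rightAcyclic.{w} T Y) :
    rightAcyclic.{w} T (X ⊞ Y) := by
  intro n hn
  refine subsingleton_of_forall_eq 0 fun x => ?_
  have := hX n hn
  have := hY n hn
  have h1 : x = (x.comp (mk₀ Limits.biprod.fst) (add_zero n)).comp (mk₀ Limits.biprod.inl)
      (add_zero n) + (x.comp (mk₀ Limits.biprod.snd) (add_zero n)).comp (mk₀ Limits.biprod.inr)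
      (add_zero n) := by
    rw [comp_assoc_of_third_deg_zero, comp_assoc_of_third_deg_zero, mk₀_comp_mk₀, mk₀_comp_mk₀,
      ← comp_add, ← mk₀_add, Limits.biprod.total, comp_mk₀_id]
  rw [h1, Subsingleton.elim (x.comp (mk₀ Limits.biprod.fst) (add_zero n)) 0,
    Subsingleton.elim (x.comp (mk₀ Limits.biprod.snd) (add_zero n)) 0, zero_comp, zero_comp, add_zero]

lemma rightAcyclic_of_injective (T X : C) (hX : Injective X) : rightAcyclic.{w} T X := by
  intro n hn
  obtain ⟨n, rfl⟩ : ∃ j, n = j + 1 := ⟨n - 1, by omega⟩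
  exact subsingleton_of_forall_eq 0 fun x => eq_zero_of_injective x

instance (T : C) : (rightAcyclic.{w} T).IsClosedUnderIsomorphisms where
  of_iso e hX := rightAcyclic_of_retract e.inv e.hom e.inv_hom_id hX

end CategoryTheory.Abelian.Ext

namespace Bimod

variable (Γ Λ : Type u) [Ring Γ] [Ring Λ]
variable (T : Type u) [AddCommGroup T] [Module Γ T] [Module Λᵐᵒᵖ T] [SMulCommClass Γ Λᵐᵒᵖ T]

/-! ### The adjunction between tensor product and `Hom` -/

section Adjunction

variable {Γ Λ T} {M : Type u} [AddCommGroup M] [Module Λ M] {N : Type u} [AddCommGroup N] [Module Γ N]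

variable (Γ Λ) in
/-- The element `t ⊗ m`. -/
def tmk (t : T) (m : M) : Tens Γ Λ T M := Submodule.Quotient.mk (t ⊗ₜ[ℤ] m)

lemma tmk_add (t : T) (m m' : M) : tmk Γ Λ t (m + m') = tmk Γ Λ t m + tmk Γ Λ t m' := by
  simp [tmk, TensorProduct.tmul_add]

lemma add_tmk (t t' : T) (m : M) : tmk Γ Λ (t + t') m = tmk Γ Λ t m + tmk Γ Λ t' m := by
  simp [tmk, TensorProduct.add_tmul]

lemma smul_tmk (g : Γ) (t : T) (m : M) : tmk Γ Λ (g • t) m = g • tmk Γ Λ t m := rfl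

lemma op_smul_tmk (l : Λ) (t : T) (m : M) : tmk Γ Λ (op l • t) m = tmk Γ Λ t (l • m) :=
  (Submodule.Quotient.eq _).2 (Submodule.subset_span ⟨t, l, m, rfl⟩)

/-- The map `t ⊗ m ↦ g m t`. -/
def tensLift (g : M →ₗ[Λ] Homs Γ Λ T N) : Tens Γ Λ T M →ₗ[Γ] N :=
  Submodule.liftQ _ (TensorProduct.AlgebraTensorModule.lift
    { toFun t :=
        { toFun m := (g m).toLin t
          map_add' m m' := by rw [map_add]; rfl
          map_smul' c m := by
            rw [map_zsmul]
            exact map_zsmul (LinearMap.applyₗ (R := ℤ) t ∘ₗ LinearMap.restrictScalarsₗ ℤ Γ T N ℤ)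
              c (g m).toLin }
      map_add' t t' := by
        ext m
        exact map_add (g m).toLin t t'
      map_smul' c t := by
        ext m
        exact map_smul (g m).toLin c t }) (by
    refine Submodule.span_le.2 ?_
    rintro _ ⟨t, l, m, rfl⟩
    rw [SetLike.mem_coe, LinearMap.mem_ker, map_sub]
    refine sub_eq_zero.2 ?_
    change (g m).toLin (op l • t) = (g (l • m)).toLin t
    rw [map_smul g l m]
    rfl)

variable (Γ T) in
/-- The map `t ↦ t ⊗ m`. -/
def tmkHom (m : M) : T →ₗ[Γ] Tens Γ Λ T M where
  toFun t := tmk Γ Λ t m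
  map_add' t t' := add_tmk t t' m
  map_smul' c t := smul_tmk c t m

/-- The map `m ↦ (t ↦ h (t ⊗ m))`. -/
def tensCurry (h : Tens Γ Λ T M →ₗ[Γ] N) : M →ₗ[Λ] Homs Γ Λ T N where
  toFun m := h.comp (tmkHom Γ T m)
  map_add' m m' := LinearMap.ext (σ := RingHom.id Γ) fun t => by
    change h (tmk Γ Λ t (m + m')) = h (tmk Γ Λ t m) + h (tmk Γ Λ t m')
    rw [tmk_add, map_add]
  map_smul' l m := LinearMap.ext (σ := RingHom.id Γ) fun t => congrArg h (op_smul_tmk l t m).symm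

end Adjunction

/-- The tensor product `T ⊗_Λ -` is left adjoint to `Hom_Γ(T, -)`. -/
def tensHomAdj : tensorFunctor Γ Λ T ⊣ homFunctor Γ Λ T :=
  Adjunction.mkOfHomEquiv
    { homEquiv _ _ :=
        { toFun h := ModuleCat.ofHom (tensCurry h.hom)
          invFun g := ModuleCat.ofHom (tensLift g.hom)
          left_inv _ := ModuleCat.hom_ext (tens_hom_ext fun _ _ => rfl)
          right_inv _ := rfl }
      homEquiv_naturality_left_symm _ _ := ModuleCat.hom_ext (tens_hom_ext fun _ _ => rfl)
      homEquiv_naturality_right _ _ := rfl }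

lemma tensHomAdj_unit_app (M : ModuleCat.{u} Λ) (m : M) :
    ((tensHomAdj Γ Λ T).unit.app M).hom m = tmkHom Γ T m := by
  rw [tensHomAdj, Adjunction.mkOfHomEquiv_unit_app]
  rfl

lemma tensHomAdj_counit_app (N : ModuleCat.{u} Γ) (t : T) (f : Homs Γ Λ T N) :
    ((tensHomAdj Γ Λ T).counit.app N).hom (tmk Γ Λ t f) = f.toLin t := by
  rw [tensHomAdj, Adjunction.mkOfHomEquiv_counit_app]
  rfl

/-! ### Tensor products with projective modules -/

section Projective

variable {Γ Λ T} (P : ModuleCat.{u} Λ)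
open Abelian

variable (Γ T) in
/-- The map `t ↦ (t l_x)_x`. -/
def finsuppMul {X : Type u} (l : X →₀ Λ) : T →ₗ[Γ] (X →₀ T) where
  toFun t := l.mapRange (fun a : Λ => op a • t) (by simp)
  map_add' t t' := by ext; simp
  map_smul' c t := by ext; simp [smul_comm]

lemma finsuppMul_apply {X : Type u} (l : X →₀ Λ) (t : T) (x : X) :
    finsuppMul Γ T l t x = op (l x) • t := rfl

/-- The map `T ⊗_Λ P → T^(P)` induced by a map `s : P → Λ^(P)`. -/
def tensToFinsupp (s : P →ₗ[Λ] (P →₀ Λ)) : Tens Γ Λ T P →ₗ[Γ] (P →₀ T) :=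
  tensLift
    { toFun p := finsuppMul Γ T (s p)
      map_add' p p' := LinearMap.ext (σ := RingHom.id Γ) fun t => Finsupp.ext fun x => by
        change op (s (p + p') x) • t = op (s p x) • t + op (s p' x) • t
        rw [map_add, Finsupp.add_apply, MulOpposite.op_add, add_smul]
      map_smul' l p := LinearMap.ext (σ := RingHom.id Γ) fun t => Finsupp.ext fun x => by
        change op (s (l • p) x) • t = op (s p x) • op l • t
        rw [map_smul, Finsupp.smul_apply, smul_eq_mul, op_mul, mul_smul] }

lemma tensToFinsupp_tmk_apply (s : P →ₗ[Λ] (P →₀ Λ)) (t : T) (p x : P) :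
    tensToFinsupp (Γ := Γ) P s (tmk Γ Λ t p) x = op (s p x) • t := rfl

/-- The map `T^(P) → T ⊗_Λ P`. -/
def finsuppToTens : (P →₀ T) →ₗ[Γ] Tens Γ Λ T P :=
  Finsupp.lsum ℕ fun p => tmkHom Γ T p

lemma finsuppToTens_finsuppMul (l : P →₀ Λ) (t : T) :
    finsuppToTens (Γ := Γ) P (finsuppMul Γ T l t) =
      tmk Γ Λ t (Finsupp.linearCombination Λ id l) := by
  induction l using Finsupp.induction_linear with
  | zero =>
    have h1 : tmk Γ Λ t (0 : P) = 0 := by simp [tmk]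
    have h2 : finsuppMul Γ T (0 : P →₀ Λ) t = 0 := by ext; simp [finsuppMul_apply]
    rw [h2, map_zero, map_zero, h1]
  | add a b ha hb =>
    rw [map_add, tmk_add, ← ha, ← hb, ← map_add]
    congr 1
    ext x
    simp [finsuppMul_apply, add_smul]
  | single x l =>
    have h2 : finsuppMul Γ T (Finsupp.single x l) t = Finsupp.single x (op l • t) :=
      Finsupp.mapRange_single (hf := by simp)
    rw [h2, Finsupp.linearCombination_single, id, ← op_smul_tmk]
    exact Finsupp.lsum_single ..

/-- A section of the canonical cover Λ^(P) → P exhibits T ⊗ P as a retract of a direct sum of copies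
of T, indexed by the elements of P. -/
lemma finsuppToTens_tensToFinsupp {s : P →ₗ[Λ] (P →₀ Λ)}
    (hs : Finsupp.linearCombination Λ id ∘ₗ s = LinearMap.id) (x : Tens Γ Λ T P) :
    finsuppToTens P (tensToFinsupp P s x) = x := by
  have : finsuppToTens P ∘ₗ tensToFinsupp P s = LinearMap.id (R := Γ) (M := Tens Γ Λ T P) := by
    refine tens_hom_ext fun t p => ?_
    refine (finsuppToTens_finsuppMul P (s p) t).trans ?_
    exact congrArg (tmk Γ Λ t) (LinearMap.congr_fun hs p)
  exact LinearMap.congr_fun this x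

lemma exists_section_linearCombination (hP : Projective P) :
    ∃ s : P →ₗ[Λ] (P →₀ Λ), Finsupp.linearCombination Λ id ∘ₗ s = LinearMap.id :=
  Module.projective_def'.1 ((IsProjective.iff_projective P).2 hP)

/-- Higher extensions vanish on T^(P) because T has finitely generated syzygies, and T ⊗ P is a
retract of T^(P). -/
lemma rightAcyclic_tensorFunctor_obj (hT : HasFGSyzygies (ModuleCat.of Γ T))
    (hext : Ext.rightAcyclic.{u} (ModuleCat.of Γ T) (ModuleCat.of Γ T)) (hP : Projective P) :
    Ext.rightAcyclic.{u} (ModuleCat.of Γ T) ((tensorFunctor Γ Λ T).obj P) := by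
  obtain ⟨s, hs⟩ := exists_section_linearCombination P hP
  refine Ext.rightAcyclic_of_retract (Y := ModuleCat.of Γ (P →₀ T))
    (ModuleCat.ofHom (tensToFinsupp P s)) (ModuleCat.ofHom (finsuppToTens P))
    (ModuleCat.hom_ext (LinearMap.ext (finsuppToTens_tensToFinsupp P hs))) fun i hi => ?_
  obtain ⟨i, rfl⟩ : ∃ j, i = j + 1 := ⟨i - 1, by omega⟩
  exact hT.subsingleton_ext_finsupp P i hext

/-- For Λ itself the unit is essentially the map Λ → End_Γ(T). Finite generation of T makes Hom_Γ(T,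
-) commute with direct sums, and a section of Λ^(P) → P carries this over to P in coordinates. -/
lemma isIso_unit_app (hT : Module.Finite Γ T)
    (hΛ : Function.Bijective fun l : Λ => rightMul Γ T l) (hP : Projective P) :
    IsIso ((tensHomAdj Γ Λ T).unit.app P) := by
  obtain ⟨s, hs⟩ := exists_section_linearCombination P hP
  rw [ConcreteCategory.isIso_iff_bijective]
  constructor
  · refine (injective_iff_map_eq_zero ((tensHomAdj Γ Λ T).unit.app P).hom).2 fun p hp => ?_
    have h1 (t : T) : tmk Γ Λ t (p : P) = 0 := by
      have h3 := (tensHomAdj_unit_app Γ Λ T P p).symm.trans hp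
      exact LinearMap.congr_fun (σ := RingHom.id Γ) h3 t
    have h2 : s p = 0 := by
      ext x
      refine hΛ.1 (LinearMap.ext fun t => ?_)
      change op (s p x) • t = op (0 : Λ) • t
      rw [← tensToFinsupp_tmk_apply (Γ := Γ), h1, map_zero, op_zero, zero_smul]
      rfl
    have := LinearMap.congr_fun hs p
    rw [LinearMap.comp_apply, h2, map_zero] at this
    exact this.symm
  · intro (f : Homs Γ Λ T (Tens Γ Λ T P))
    obtain ⟨S, hS⟩ := exists_finset_support_subset (tensToFinsupp P s ∘ₗ f.toLin)
    -- Each coordinate of f is an endomorphism of T, hence right multiplication by some `l x`. Only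
    -- finitely many are nonzero since T is finitely generated, so they form the element `L` of
    -- Λ^(P).
    choose l hl using fun x : P => hΛ.2 (Finsupp.lapply x ∘ₗ tensToFinsupp P s ∘ₗ f.toLin)
    have hl' (x : P) (t : T) : op (l x) • t = tensToFinsupp P s (f.toLin t) x :=
      LinearMap.congr_fun (hl x) t
    classical
    let L : P →₀ Λ := Finsupp.onFinset S (fun x => l x) fun x hx => by
      by_contra hxS
      refine hx (hΛ.1 (LinearMap.ext fun t => ?_))
      change op (l x) • t = op (0 : Λ) • t
      rw [hl', op_zero, zero_smul]
      exact Finsupp.notMem_support_iff.1 fun h => hxS (hS t h)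
    refine ⟨Finsupp.linearCombination Λ id L, LinearMap.ext (σ := RingHom.id Γ) fun t => ?_⟩
    refine (LinearMap.congr_fun (σ := RingHom.id Γ) (tensHomAdj_unit_app Γ Λ T P _) t).trans ?_
    change tmk Γ Λ t _ = _
    rw [← finsuppToTens_finsuppMul]
    refine Eq.trans ?_ (finsuppToTens_tensToFinsupp P hs (f.toLin t))
    congr 1
    ext x
    exact hl' x t

end Projective

/-! ### Exactness of `Hom_Γ(T, -)` -/

lemma homFunctor_acyclic {d : ℕ} [HasProjectiveDimensionLT (ModuleCat.of Γ T) d]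
    (K : CochainComplex (ModuleCat.{u} Γ) ℤ) (hK : K.Acyclic)
    (hT : ∀ n : ℤ, Abelian.Ext.rightAcyclic.{u} (ModuleCat.of Γ T) (K.X n)) :
    (((homFunctor Γ Λ T).mapHomologicalComplex _).obj K).Acyclic := by
  intro n
  rw [HomologicalComplex.exactAt_iff' _ (n - 1) n (n + 1) (by simp) (by simp),
    ShortComplex.moduleCat_exact_iff]
  intro (f : Homs Γ Λ T (K.X n)) hf
  obtain ⟨g, hg⟩ := CochainComplex.exists_lift_of_acyclic (d := d) hK hT (sub_add_cancel n 1)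
    (ModuleCat.ofHom f.toLin) (ModuleCat.hom_ext hf)
  exact ⟨g.hom, congrArg ModuleCat.Hom.hom hg⟩

end Bimod

end

noncomputable section

namespace Bimod

/-! ### The tensor product of a right module and a left module, as an abelian group -/

section GroupTens

variable (Λ : Type*) [Ring Λ] (S : Type*) [AddCommGroup S] [Module Λᵐᵒᵖ S]
  (M : Type*) [AddCommGroup M] [Module Λ M]

/-- The subgroup of `S ⊗_ℤ M` generated by all elements `s l ⊗ m - s ⊗ l m`. -/
def groupBalancing : AddSubgroup (S ⊗[ℤ] M) :=
  AddSubgroup.closure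
    {x | ∃ (s : S) (l : Λ) (m : M), x = (op l • s) ⊗ₜ[ℤ] m - s ⊗ₜ[ℤ] (l • m)}

/-- The abelian group `S ⊗_Λ M`. -/
abbrev GroupTens : Type _ := (S ⊗[ℤ] M) ⧸ groupBalancing Λ S M

variable {S M}

/-- The element `s ⊗ m` of `S ⊗_Λ M`. -/
def gmk (s : S) (m : M) : GroupTens Λ S M := QuotientAddGroup.mk (s ⊗ₜ[ℤ] m)

variable {Λ}

lemma gmk_add (s : S) (m m' : M) : gmk Λ s (m + m') = gmk Λ s m + gmk Λ s m' := by
  simp [gmk, TensorProduct.tmul_add]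

lemma add_gmk (s s' : S) (m : M) : gmk Λ (s + s') m = gmk Λ s m + gmk Λ s' m := by
  simp [gmk, TensorProduct.add_tmul]

lemma op_smul_gmk (l : Λ) (s : S) (m : M) : gmk Λ (op l • s) m = gmk Λ s (l • m) := by
  refine (QuotientAddGroup.eq_iff_sub_mem).2 (AddSubgroup.subset_closure ⟨s, l, m, rfl⟩)

/-- The map `m ↦ s ⊗ m`. -/
def gmkHom (s : S) : M →+ GroupTens Λ S M := AddMonoidHom.mk' (gmk Λ s) (gmk_add s)

/-- The map `s ↦ s ⊗ m`. -/
def gmkHom' (m : M) : S →+ GroupTens Λ S M :=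
  AddMonoidHom.mk' (fun s => gmk Λ s m) fun s s' => add_gmk s s' m

@[elab_as_elim]
lemma GroupTens.induction {motive : GroupTens Λ S M → Prop} (x : GroupTens Λ S M)
    (mk : ∀ s m, motive (gmk Λ s m)) (add : ∀ x y, motive x → motive y → motive (x + y)) :
    motive x := by
  obtain ⟨y, rfl⟩ := QuotientAddGroup.mk_surjective x
  induction y using TensorProduct.induction_on with
  | zero =>
    rw [← TensorProduct.tmul_zero M (0 : S)]
    exact mk 0 0
  | tmul s m => exact mk s m
  | add a b ha hb => exact add _ _ ha hb

/-- The map out of `S ⊗_Λ M` given by a balanced biadditive map. -/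
def gLift {A : Type*} [AddCommGroup A] (f : S →+ M →+ A)
    (h : ∀ (s : S) (l : Λ) (m : M), f (op l • s) m = f s (l • m)) : GroupTens Λ S M →+ A :=
  QuotientAddGroup.lift _ (TensorProduct.liftAddHom f fun c s m => by
    rw [map_zsmul, map_zsmul, AddMonoidHom.coe_smul, Pi.smul_apply]) (by
    refine (AddSubgroup.closure_le _).2 ?_
    rintro _ ⟨s, l, m, rfl⟩
    rw [SetLike.mem_coe, AddMonoidHom.mem_ker, map_sub]
    exact sub_eq_zero.2 (h s l m))

variable {S' : Type*} [AddCommGroup S'] [Module Λᵐᵒᵖ S'] {M' : Type*} [AddCommGroup M'] [Module Λ M']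

variable (M) in
/-- The map `f ⊗ M`. -/
def gMapLeft (f : S →ₗ[Λᵐᵒᵖ] S') : GroupTens Λ S M →+ GroupTens Λ S' M :=
  gLift (AddMonoidHom.mk' (fun s => gmkHom (f s)) fun s s' => by
      ext m
      change gmk Λ (f (s + s')) m = _
      rw [map_add, add_gmk]
      rfl) fun s l m => by
    change gmk Λ (f (op l • s)) m = gmk Λ (f s) (l • m)
    rw [map_smul, op_smul_gmk]

variable (S) in
/-- The map `S ⊗ g`. -/
def gMapRight (g : M →ₗ[Λ] M') : GroupTens Λ S M →+ GroupTens Λ S M' :=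
  gLift (AddMonoidHom.mk' (fun s => (gmkHom s).comp g.toAddMonoidHom) fun s s' => by
      ext m
      exact add_gmk s s' (g m)) fun s l m => by
    change gmk Λ (op l • s) (g m) = gmk Λ s (g (l • m))
    rw [map_smul, op_smul_gmk]

@[simp]
lemma gMapLeft_gmk (f : S →ₗ[Λᵐᵒᵖ] S') (s : S) (m : M) :
    gMapLeft M f (gmk Λ s m) = gmk Λ (f s) m := rfl

@[simp]
lemma gMapRight_gmk (g : M →ₗ[Λ] M') (s : S) (m : M) :
    gMapRight S g (gmk Λ s m) = gmk Λ s (g m) := rfl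

lemma gMapRight_gMapLeft (f : S →ₗ[Λᵐᵒᵖ] S') (g : M →ₗ[Λ] M') (x : GroupTens Λ S M) :
    gMapRight S' g (gMapLeft M f x) = gMapLeft M' f (gMapRight S g x) :=
  x.induction (fun _ _ => rfl) fun x y hx hy => by simp only [map_add, hx, hy]

lemma gMapRight_comp {M'' : Type*} [AddCommGroup M''] [Module Λ M''] (g : M →ₗ[Λ] M')
    (g' : M' →ₗ[Λ] M'') (x : GroupTens Λ S M) :
    gMapRight S g' (gMapRight S g x) = gMapRight S (g' ∘ₗ g) x :=
  x.induction (fun _ _ => rfl) fun x y hx hy => by simp only [map_add, hx, hy]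

lemma gMapLeft_comp {S'' : Type*} [AddCommGroup S''] [Module Λᵐᵒᵖ S''] (f : S →ₗ[Λᵐᵒᵖ] S')
    (f' : S' →ₗ[Λᵐᵒᵖ] S'') (x : GroupTens Λ S M) :
    gMapLeft M f' (gMapLeft M f x) = gMapLeft M (f' ∘ₗ f) x :=
  x.induction (fun _ _ => rfl) fun x y hx hy => by simp only [map_add, hx, hy]

lemma gMapRight_id (x : GroupTens Λ S M) : gMapRight S LinearMap.id x = x :=
  x.induction (fun _ _ => rfl) fun x y hx hy => by simp only [map_add, hx, hy]

lemma gMapRight_add (g g' : M →ₗ[Λ] M') (x : GroupTens Λ S M) :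
    gMapRight S (g + g') x = gMapRight S g x + gMapRight S g' x :=
  x.induction (fun s m => gmk_add s (g m) (g' m)) fun x y hx hy => by
    simp only [map_add, hx, hy]
    abel

lemma gMapRight_zero (x : GroupTens Λ S M) : gMapRight S (0 : M →ₗ[Λ] M') x = 0 :=
  x.induction (fun s _ => map_zero (gmkHom (Λ := Λ) (M := M') s)) fun x y hx hy => by
    rw [map_add, hx, hy, add_zero]

lemma gMapLeft_zero (x : GroupTens Λ S M) : gMapLeft M (0 : S →ₗ[Λᵐᵒᵖ] S') x = 0 :=
  x.induction (fun _ m => map_zero (gmkHom' (Λ := Λ) (S := S') m)) fun x y hx hy => by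
    rw [map_add, hx, hy, add_zero]

lemma gMapLeft_surjective {f : S →ₗ[Λᵐᵒᵖ] S'} (hf : Function.Surjective f) :
    Function.Surjective (gMapLeft M f) := by
  intro x
  induction x using GroupTens.induction with
  | mk s m =>
    obtain ⟨s, rfl⟩ := hf s
    exact ⟨gmk Λ s m, rfl⟩
  | add x y hx hy =>
    obtain ⟨x, rfl⟩ := hx
    obtain ⟨y, rfl⟩ := hy
    exact ⟨x + y, map_add _ _ _⟩

/-- The tensor product is right exact in the first variable. -/
lemma exists_gMapLeft_eq {S'' : Type*} [AddCommGroup S''] [Module Λᵐᵒᵖ S''] {i : S →ₗ[Λᵐᵒᵖ] S'}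
    {p : S' →ₗ[Λᵐᵒᵖ] S''} (hp : Function.Surjective p) (hip : Function.Exact i p)
    (x : GroupTens Λ S' M) (hx : gMapLeft M p x = 0) : ∃ y, gMapLeft M i y = x := by
  let π : GroupTens Λ S' M →+ GroupTens Λ S' M ⧸ (gMapLeft M i).range := QuotientAddGroup.mk' _
  have hπ {s s' : S'} (h : p s = p s') (m : M) : π (gmk Λ s m) = π (gmk Λ s' m) := by
    obtain ⟨a, ha⟩ := (hip (s - s')).1 (by rw [map_sub, h, sub_self])
    refine QuotientAddGroup.eq_iff_sub_mem.2 ⟨gmk Λ a m, ?_⟩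
    rw [gMapLeft_gmk, ha]
    exact map_sub (gmkHom' (Λ := Λ) m) s s'
  choose r hr using hp
  -- An inverse from S'' ⊗ M to the cokernel of i ⊗ M: lift s set-theoretically; modulo the image of
  -- i ⊗ M the choice of lift does not matter.
  let φ : GroupTens Λ S'' M →+ GroupTens Λ S' M ⧸ (gMapLeft M i).range :=
    gLift (AddMonoidHom.mk' (fun s => π.comp (gmkHom (r s))) fun s s' => by
      ext m
      refine (hπ (s' := r s + r s') (by simp [hr]) m).trans ?_
      rw [add_gmk, map_add]
      rfl) fun s l m => by
        refine (hπ (s' := op l • r s) (by simp [hr]) m).trans ?_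
        rw [op_smul_gmk]
        rfl
  have h (x : GroupTens Λ S' M) : φ (gMapLeft M p x) = π x :=
    x.induction (fun s m => hπ (hr _) m) fun x y hx hy => by simp only [map_add, hx, hy]
  have h2 : π x = 0 := by rw [← h, hx, map_zero]
  exact (QuotientAddGroup.eq_zero_iff x).1 h2

end GroupTens

/-! ### Projective right modules -/

section DualBasis

variable {Λ : Type*} [Ring Λ] {S : Type*} [AddCommGroup S] [Module Λᵐᵒᵖ S]
  {M : Type*} [AddCommGroup M] [Module Λ M] {M' : Type*} [AddCommGroup M'] [Module Λ M']

lemma exists_dualBasis (R Q : Type*) [Ring R] [AddCommGroup Q] [Module R Q] [Module.Finite R Q]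
    [Module.Projective R Q] : ∃ (n : ℕ) (q : Fin n → Q) (c : Fin n → Q →ₗ[R] R),
      ∀ x, ∑ j, c j x • q j = x := by
  obtain ⟨n, f, hf⟩ := Module.Finite.exists_fin' R Q
  obtain ⟨s, hs⟩ := Module.projective_lifting_property f LinearMap.id hf
  refine ⟨n, fun j => f (Pi.single j 1), fun j => LinearMap.proj j ∘ₗ s, fun x => ?_⟩
  refine Eq.trans ?_ (LinearMap.congr_fun hs x)
  rw [LinearMap.comp_apply, LinearMap.pi_apply_eq_sum_univ f (s x)]
  refine Finset.sum_congr rfl fun j _ => ?_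
  simp only [LinearMap.comp_apply, LinearMap.proj_apply]
  congr 2
  funext k
  simp [Pi.single_apply, eq_comm]

variable (M) in
/-- The map `s ⊗ m ↦ c(s) m` given by a linear form `c`. -/
def gCoord (c : S →ₗ[Λᵐᵒᵖ] Λᵐᵒᵖ) : GroupTens Λ S M →+ M :=
  gLift (AddMonoidHom.mk' (fun s => AddMonoidHom.mk' (fun m => unop (c s) • m) (smul_add _))
      fun s s' => by
        ext m
        simp [add_smul]) fun s l m => by simp [mul_smul]

@[simp]
lemma gCoord_gmk (c : S →ₗ[Λᵐᵒᵖ] Λᵐᵒᵖ) (s : S) (m : M) :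
    gCoord M c (gmk Λ s m) = unop (c s) • m := rfl

lemma gCoord_gMapRight (c : S →ₗ[Λᵐᵒᵖ] Λᵐᵒᵖ) (g : M →ₗ[Λ] M') (x : GroupTens Λ S M) :
    gCoord M' c (gMapRight S g x) = g (gCoord M c x) :=
  x.induction (fun s m => by simp) fun x y hx hy => by simp only [map_add, hx, hy]

lemma sum_gmk_gCoord {n : ℕ} {q : Fin n → S} {c : Fin n → S →ₗ[Λᵐᵒᵖ] Λᵐᵒᵖ}
    (h : ∀ x, ∑ j, c j x • q j = x) (x : GroupTens Λ S M) :
    ∑ j, gmk Λ (q j) (gCoord M (c j) x) = x := by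
  induction x using GroupTens.induction with
  | mk s m =>
    conv_rhs => rw [← h s]
    refine Eq.trans ?_ (map_sum (gmkHom' (Λ := Λ) (S := S) m) _ _).symm
    refine Finset.sum_congr rfl fun j _ => ?_
    rw [gCoord_gmk, ← op_smul_gmk, op_unop]
    rfl
  | add x y hx hy =>
    conv_rhs => rw [← hx, ← hy]
    rw [← Finset.sum_add_distrib]
    refine Finset.sum_congr rfl fun j _ => ?_
    rw [map_add, gmk_add]

/-- A dual basis writes x as Σ qⱼ ⊗ cⱼ(x), so it suffices to lift the coordinates cⱼ(x) along f one
by one. -/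
lemma exists_gMapRight_eq {M'' : Type*} [AddCommGroup M''] [Module Λ M'']
    [Module.Finite Λᵐᵒᵖ S] [Module.Projective Λᵐᵒᵖ S] {f : M →ₗ[Λ] M'} {g : M' →ₗ[Λ] M''}
    (hfg : Function.Exact f g) (x : GroupTens Λ S M') (hx : gMapRight S g x = 0) :
    ∃ y, gMapRight S f y = x := by
  obtain ⟨n, q, c, h⟩ := exists_dualBasis Λᵐᵒᵖ S
  choose y hy using fun j => (hfg (gCoord M' (c j) x)).1
    (by rw [← gCoord_gMapRight, hx, map_zero])
  refine ⟨∑ j, gmk Λ (q j) (y j), ?_⟩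
  rw [map_sum]
  simp only [gMapRight_gmk, hy, sum_gmk_gCoord h]

/-- The map `s ⊗ m ↦ s c(m)` given by a linear form `c`. -/
def gCoord' (S : Type*) [AddCommGroup S] [Module Λᵐᵒᵖ S] (c : M →ₗ[Λ] Λ) : GroupTens Λ S M →+ S :=
  gLift (AddMonoidHom.mk' (fun s => AddMonoidHom.mk' (fun m => op (c m) • s) (by simp [add_smul]))
      fun s s' => by
        ext m
        simp) fun s l m => by simp [mul_smul]

@[simp]
lemma gCoord'_gmk (c : M →ₗ[Λ] Λ) (s : S) (m : M) :
    gCoord' S c (gmk Λ s m) = op (c m) • s := rfl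

lemma gCoord'_gMapLeft {S' : Type*} [AddCommGroup S'] [Module Λᵐᵒᵖ S'] (c : M →ₗ[Λ] Λ)
    (f : S →ₗ[Λᵐᵒᵖ] S') (x : GroupTens Λ S M) :
    gCoord' S' c (gMapLeft M f x) = f (gCoord' S c x) :=
  x.induction (fun s m => by simp) fun x y hx hy => by simp only [map_add, hx, hy]

/-- Projective modules are flat. -/
lemma gMapLeft_injective_of_projective [Module.Projective Λ M]
    {S' : Type*} [AddCommGroup S'] [Module Λᵐᵒᵖ S'] {f : S →ₗ[Λᵐᵒᵖ] S'}
    (hf : Function.Injective f) : Function.Injective (gMapLeft M f) := by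
  classical
  obtain ⟨σ, hσ⟩ := Module.projective_def'.1 ‹Module.Projective Λ M›
  let c (m : M) : M →ₗ[Λ] Λ := Finsupp.lapply m ∘ₗ σ
  -- M need not be finitely generated, so the finite set of basis elements depends on x. Allowing
  -- every larger set makes the claim stable under sums.
  have key (x : GroupTens Λ S M) : ∃ F : Finset M, ∀ F', F ⊆ F' →
      x = ∑ m ∈ F', gmk Λ (gCoord' S (c m) x) m := by
    induction x using GroupTens.induction with
    | mk s m =>
      refine ⟨(σ m).support, fun F' hF' => ?_⟩
      have h1 : ∑ m' ∈ F', σ m m' • m' = m := by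
        refine Eq.trans ?_ (LinearMap.congr_fun hσ m)
        rw [LinearMap.comp_apply, Finsupp.linearCombination_apply,
          Finsupp.sum_of_support_subset _ hF' _ (by simp)]
        rfl
      conv_lhs => rw [← h1]
      refine (map_sum (gmkHom (Λ := Λ) (M := M) s) _ _).trans ?_
      refine Finset.sum_congr rfl fun m' _ => ?_
      rw [gCoord'_gmk, op_smul_gmk]
      rfl
    | add x y hx hy =>
      obtain ⟨F, hF⟩ := hx
      obtain ⟨F₂, hF₂⟩ := hy
      refine ⟨F ∪ F₂, fun F' hF' => ?_⟩
      conv_lhs => rw [hF F' (Finset.union_subset_left hF'), hF₂ F' (Finset.union_subset_right hF')]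
      rw [← Finset.sum_add_distrib]
      refine Finset.sum_congr rfl fun m _ => ?_
      rw [map_add, add_gmk]
  refine (injective_iff_map_eq_zero _).2 fun x hx => ?_
  obtain ⟨F, hF⟩ := key x
  rw [hF F subset_rfl]
  refine Finset.sum_eq_zero fun m _ => ?_
  have : gCoord' S (c m) x = 0 := hf (by rw [← gCoord'_gMapLeft, hx, map_zero, map_zero])
  rw [this]
  exact map_zero (gmkHom' (Λ := Λ) m)

end DualBasis

/-! ### Comparison with the `Γ`-module `T ⊗_Λ M` -/

section Compare

variable (Γ Λ : Type u) [Ring Γ] [Ring Λ]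
variable (T : Type u) [AddCommGroup T] [Module Γ T] [Module Λᵐᵒᵖ T] [SMulCommClass Γ Λᵐᵒᵖ T]
variable (M : Type u) [AddCommGroup M] [Module Λ M]

lemma balancing_toAddSubgroup : (balancing Γ Λ T M).toAddSubgroup = groupBalancing Λ T M := by
  refine le_antisymm (fun x (hx : x ∈ balancing Γ Λ T M) => ?_) ((AddSubgroup.closure_le _).2 ?_)
  · refine Submodule.closure_induction (p := fun x _ => x ∈ groupBalancing Λ T M) (zero_mem _)
      (fun _ _ _ _ => add_mem) ?_ hx
    rintro c _ ⟨t, l, m, rfl⟩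
    refine AddSubgroup.subset_closure ⟨c • t, l, m, ?_⟩
    rw [smul_sub, ← smul_comm c (op l) t]
    rfl
  · rintro _ ⟨t, l, m, rfl⟩
    exact Submodule.subset_span ⟨t, l, m, rfl⟩

/-- The underlying group of `T ⊗_Λ M`. -/
def tensEquiv : Tens Γ Λ T M ≃+ GroupTens Λ T M :=
  QuotientAddGroup.quotientAddEquivOfEq (balancing_toAddSubgroup Γ Λ T M)

variable {M} in
lemma tensEquiv_tensMap {M' : Type u} [AddCommGroup M'] [Module Λ M'] (f : M →ₗ[Λ] M')
    (x : Tens Γ Λ T M) :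
    tensEquiv Γ Λ T M' (tensMap Γ Λ T f x) = gMapRight T f (tensEquiv Γ Λ T M x) := by
  obtain ⟨y, rfl⟩ := Submodule.Quotient.mk_surjective _ x
  induction y using TensorProduct.induction_on with
  | zero => simp
  | tmul t m => rfl
  | add a b ha hb => rw [Submodule.Quotient.mk_add, map_add, map_add, map_add, map_add, ha, hb]

end Compare

end Bimod

end

noncomputable section

namespace Bimod

/-! ### Evaluation maps `S ⊗_Λ Hom_Γ(T, I) → Hom_Γ(Hom_Λᵒ(S, T), I)` -/

section Evaluation

variable (Γ Λ : Type u) [Ring Γ] [Ring Λ]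
variable (T : Type u) [AddCommGroup T] [Module Γ T] [Module Λᵐᵒᵖ T] [SMulCommClass Γ Λᵐᵒᵖ T]
  [SMulCommClass Λᵐᵒᵖ Γ T]
variable (S : Type u) [AddCommGroup S] [Module Λᵐᵒᵖ S] (I : Type u) [AddCommGroup I] [Module Γ I]

/-- The map `s ⊗ f ↦ (h ↦ f (h s))`. -/
def evalTens : GroupTens Λ S (Homs Γ Λ T I) →+ (S →ₗ[Λᵐᵒᵖ] T) →ₗ[Γ] I :=
  gLift (AddMonoidHom.mk' (fun s => AddMonoidHom.mk'
      (fun f => f.toLin ∘ₗ LinearMap.applyₗ' Γ s) fun _ _ => rfl) fun s s' => by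
        ext f h
        change f.toLin (h (s + s')) = f.toLin (h s) + f.toLin (h s')
        rw [map_add, map_add]) fun s l f => by
    ext h
    change f.toLin (h (op l • s)) = f.toLin (op l • h s)
    rw [map_smul]

variable {S} {S' : Type u} [AddCommGroup S'] [Module Λᵐᵒᵖ S']

variable {Λ} in
/-- The map `Hom(S', T) → Hom(S, T)` induced by `i : S → S'`. -/
def precomp (i : S →ₗ[Λᵐᵒᵖ] S') : (S' →ₗ[Λᵐᵒᵖ] T) →ₗ[Γ] (S →ₗ[Λᵐᵒᵖ] T) where
  toFun h := h ∘ₗ i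
  map_add' _ _ := rfl
  map_smul' _ _ := rfl

lemma evalTens_gMapLeft (i : S →ₗ[Λᵐᵒᵖ] S') (x : GroupTens Λ S (Homs Γ Λ T I)) :
    evalTens Γ Λ T S' I (gMapLeft _ i x) = evalTens Γ Λ T S I x ∘ₗ precomp Γ T i :=
  x.induction (fun _ _ => rfl) fun x y hx hy => by
    rw [map_add, map_add, map_add, hx, hy, LinearMap.add_comp]

variable {Γ Λ T I}

/-- Evaluation at the rank-one map s ↦ c(s) t recovers the coordinates of x; this yields injectivity
in the projective case. -/
lemma evalTens_smulRight (c : S →ₗ[Λᵐᵒᵖ] Λᵐᵒᵖ) (t : T) (x : GroupTens Λ S (Homs Γ Λ T I)) :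
    evalTens Γ Λ T S I x (c.smulRight t) = (gCoord _ c x).toLin t := by
  induction x using GroupTens.induction with
  | mk s f => rfl
  | add x y hx hy =>
    rw [map_add, map_add, LinearMap.add_apply, hx, hy]
    rfl

section Projective

variable [Module.Finite Λᵐᵒᵖ S] [Module.Projective Λᵐᵒᵖ S]

lemma evalTens_injective_of_projective : Function.Injective (evalTens Γ Λ T S I) := by
  obtain ⟨n, q, c, h⟩ := exists_dualBasis Λᵐᵒᵖ S
  refine (injective_iff_map_eq_zero _).2 fun x hx => ?_
  rw [← sum_gmk_gCoord h x]
  refine Finset.sum_eq_zero fun j _ => ?_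
  have : gCoord _ (c j) x = 0 := LinearMap.ext (σ := RingHom.id Γ) fun t => by
    refine (evalTens_smulRight (c j) t x).symm.trans ?_
    rw [hx]
    rfl
  rw [this]
  exact map_zero (gmkHom (Λ := Λ) (M := Homs Γ Λ T I) (q j))

lemma evalTens_surjective_of_projective : Function.Surjective (evalTens Γ Λ T S I) := by
  obtain ⟨n, q, c, h⟩ := exists_dualBasis Λᵐᵒᵖ S
  intro φ
  -- Any g : S → T is the sum of the rank-one maps given by cⱼ and g(qⱼ), so φ is determined by its
  -- restrictions to these.
  let f (j : Fin n) : T →ₗ[Γ] I := φ ∘ₗ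
    { toFun t := (c j).smulRight t
      map_add' t t' := by ext; simp
      map_smul' a t := LinearMap.ext fun s => smul_comm (c j s) a t }
  refine ⟨∑ j, gmk Λ (q j) (f j : Homs Γ Λ T I), LinearMap.ext fun g => ?_⟩
  rw [map_sum, LinearMap.sum_apply]
  refine (map_sum φ (fun j => (c j).smulRight (g (q j))) Finset.univ).symm.trans ?_
  congr 1
  ext x
  conv_rhs => rw [← h x]
  simp [LinearMap.sum_apply]

end Projective

variable {S'' : Type u} [AddCommGroup S''] [Module Λᵐᵒᵖ S'']

/-- Surjectivity of p embeds Hom(S', T) in Hom(S, T). Injectivity of I extends the functional to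
Hom(S, T), where the projective case applies, and p carries the preimage to S' ⊗ Hom(T, I). -/
lemma evalTens_surjective [Module.Finite Λᵐᵒᵖ S] [Module.Projective Λᵐᵒᵖ S] [Module.Injective Γ I]
    {p : S →ₗ[Λᵐᵒᵖ] S'} (hp : Function.Surjective p) :
    Function.Surjective (evalTens Γ Λ T S' I) := by
  intro φ
  obtain ⟨ψ, hψ⟩ := Module.Injective.out (precomp Γ T p)
    (fun h h' e => LinearMap.ext fun s => by
      obtain ⟨s, rfl⟩ := hp s
      exact LinearMap.congr_fun e s) φ
  obtain ⟨x, rfl⟩ := evalTens_surjective_of_projective (S := S) ψ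
  exact ⟨gMapLeft _ p x, LinearMap.ext fun h =>
    (LinearMap.congr_fun (evalTens_gMapLeft Γ Λ T I p x) h).trans (hψ h)⟩

/-- If x ∈ S' ⊗ Hom(T, I) has evaluation zero over S'', then its evaluation over S' kills the maps
vanishing on S, so it descends to a functional on Hom(S, T). That functional comes from some z; then
x is the image of z and dies in S'' ⊗ Hom(T, I). -/
lemma evalTens_injective [Module.Finite Λᵐᵒᵖ S'] [Module.Projective Λᵐᵒᵖ S']
    {i : S →ₗ[Λᵐᵒᵖ] S'} {p : S' →ₗ[Λᵐᵒᵖ] S''} (hp : Function.Surjective p)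
    (hip : Function.Exact i p) (hi : Function.Surjective (precomp Γ T i))
    (hS : Function.Surjective (evalTens Γ Λ T S I)) :
    Function.Injective (evalTens Γ Λ T S'' I) := by
  refine (injective_iff_map_eq_zero _).2 fun y hy => ?_
  obtain ⟨x, rfl⟩ := gMapLeft_surjective hp y
  rw [evalTens_gMapLeft] at hy
  have h1 : LinearMap.ker (precomp Γ T i) ≤ LinearMap.ker (evalTens Γ Λ T S' I x) := by
    intro h hh
    have h2 : LinearMap.ker p ≤ LinearMap.ker h := by
      intro s hs
      obtain ⟨a, rfl⟩ := (hip s).1 hs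
      exact LinearMap.congr_fun hh a
    let h' : S'' →ₗ[Λᵐᵒᵖ] T := (LinearMap.ker p).liftQ h h2 ∘ₗ
      (p.quotKerEquivOfSurjective hp).symm.toLinearMap
    have h3 : precomp Γ T p h' = h := by
      ext s
      have : (p.quotKerEquivOfSurjective hp).symm (p s) = Submodule.Quotient.mk s := by
        rw [LinearEquiv.symm_apply_eq]
        rfl
      change (LinearMap.ker p).liftQ h h2 ((p.quotKerEquivOfSurjective hp).symm (p s)) = h s
      rw [this]
      rfl
    rw [LinearMap.mem_ker, ← h3]
    exact LinearMap.congr_fun hy h'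
  let φ : (S →ₗ[Λᵐᵒᵖ] T) →ₗ[Γ] I := (LinearMap.ker (precomp Γ T i)).liftQ _ h1 ∘ₗ
    ((precomp Γ T i).quotKerEquivOfSurjective hi).symm.toLinearMap
  obtain ⟨z, hz⟩ := hS φ
  have h4 : gMapLeft _ i z = x := by
    refine evalTens_injective_of_projective (LinearMap.ext fun h => ?_)
    rw [evalTens_gMapLeft, hz]
    have : ((precomp Γ T i).quotKerEquivOfSurjective hi).symm (precomp Γ T i h) =
        Submodule.Quotient.mk h := by
      rw [LinearEquiv.symm_apply_eq]
      rfl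
    change (LinearMap.ker (precomp Γ T i)).liftQ _ h1
      (((precomp Γ T i).quotKerEquivOfSurjective hi).symm (precomp Γ T i h)) = _
    rw [this]
    rfl
  rw [← h4, gMapLeft_comp, show p ∘ₗ i = 0 from hip.linearMap_comp_eq_zero, gMapLeft_zero]

/-- An element z killed by i evaluates to zero on restrictions of maps S' → T, and by `hi` every map
S → T is such a restriction. -/
lemma gMapLeft_homs_injective {i : S →ₗ[Λᵐᵒᵖ] S'} (hi : Function.Surjective (precomp Γ T i))
    (hS : Function.Injective (evalTens Γ Λ T S I)) :
    Function.Injective (gMapLeft (Homs Γ Λ T I) i) := by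
  refine (injective_iff_map_eq_zero _).2 fun z hz => ?_
  refine hS (LinearMap.ext fun h => ?_)
  obtain ⟨h, rfl⟩ := hi h
  refine (LinearMap.congr_fun (evalTens_gMapLeft Γ Λ T I i z) h).symm.trans ?_
  rw [hz, map_zero, map_zero]
  rfl

end Evaluation

/-! ### Bijectivity of the evaluation maps and the counit on injective modules -/

section Counit

variable {Γ Λ : Type u} [Ring Γ] [Ring Λ]
variable {T : Type u} [AddCommGroup T] [Module Γ T] [Module Λᵐᵒᵖ T] [SMulCommClass Γ Λᵐᵒᵖ T]
open Abelian

variable {S S' S'' : ModuleCat.{u} Λᵐᵒᵖ} {i : S ⟶ S'} {p : S' ⟶ S''} {w : i ≫ p = 0}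

lemma precomp_surjective [SMulCommClass Λᵐᵒᵖ Γ T] (hE : (ShortComplex.mk i p w).ShortExact)
    (h : Subsingleton (Ext.{u} S'' (ModuleCat.of Λᵐᵒᵖ T) 1)) :
    Function.Surjective (precomp Γ T i.hom) := by
  intro f
  obtain ⟨g, hg⟩ := hE.exists_extension h (ModuleCat.ofHom f)
  exact ⟨g.hom, congrArg ModuleCat.Hom.hom hg⟩

/-- Ext¹(S, T) = 0 lets maps into T extend from the first syzygy S₁ to Q. Apart from that,
injectivity for S needs only surjectivity for S₁, which follows from a finitely generated projective
cover of S₁. -/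
lemma HasFGSyzygies.evalTens_bijective [SMulCommClass Λᵐᵒᵖ Γ T] (hS : HasFGSyzygies S)
    (h : Subsingleton (Ext.{u} S (ModuleCat.of Λᵐᵒᵖ T) 1)) (I : Type u) [AddCommGroup I]
    [Module Γ I] [Module.Injective Γ I] : Function.Bijective (evalTens Γ Λ T S I) := by
  obtain ⟨S₁, Q, i, p, w, hS₁, hE, hQ, hQ'⟩ := hS.exists_syzygy
  obtain ⟨S₂, Q₁, i₁, p₁, w₁, -, hE₁, hQ₁, hQ₁'⟩ := hS₁.exists_syzygy
  have := (IsProjective.iff_projective Q).2 hQ'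
  have := (IsProjective.iff_projective Q₁).2 hQ₁'
  exact ⟨evalTens_injective hE.moduleCat_surjective_g
    ((ShortComplex.ShortExact.moduleCat_exact_iff_function_exact _).1 hE.exact)
    (precomp_surjective hE h) (evalTens_surjective hE₁.moduleCat_surjective_g),
    evalTens_surjective hE.moduleCat_surjective_g⟩

/-- The counit is the evaluation map for S = T followed by evaluation at the identity. Since Γ is
the endomorphism ring of T over Λᵒ, the latter is the isomorphism Hom_Γ(Γ, I) ≅ I. -/
lemma isIso_counit_app (hT : HasFGSyzygies (ModuleCat.of Λᵐᵒᵖ T))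
    (h : Subsingleton (Ext.{u} (ModuleCat.of Λᵐᵒᵖ T) (ModuleCat.of Λᵐᵒᵖ T) 1))
    (hΓ : Function.Bijective fun g : Γ => leftMul Λ T g) (I : ModuleCat.{u} Γ) (hI : Injective I) :
    IsIso ((tensHomAdj Γ Λ T).counit.app I) := by
  have := SMulCommClass.symm Γ Λᵐᵒᵖ T
  have := Module.injective_module_of_injective_object Γ I
  have hb := hT.evalTens_bijective (Γ := Γ) h I
  let ε : Tens Γ Λ T (Homs Γ Λ T I) →ₗ[Γ] I := ((tensHomAdj Γ Λ T).counit.app I).hom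
  have key (x : Tens Γ Λ T (Homs Γ Λ T I)) : ε x =
      evalTens Γ Λ T T I (tensEquiv Γ Λ T _ x) LinearMap.id := by
    obtain ⟨y, rfl⟩ := Submodule.Quotient.mk_surjective _ x
    induction y using TensorProduct.induction_on with
    | zero => simp
    | tmul t f => exact tensHomAdj_counit_app Γ Λ T I t f
    | add a b ha hb =>
      rw [Submodule.Quotient.mk_add, map_add, map_add, map_add, ha, hb, LinearMap.add_apply]
  rw [ConcreteCategory.isIso_iff_bijective]
  change Function.Bijective ε
  constructor
  · refine (injective_iff_map_eq_zero ε).2 fun x hx => ?_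
    rw [key] at hx
    refine (tensEquiv Γ Λ T _).injective (hb.1 (LinearMap.ext fun f => ?_))
    obtain ⟨g, rfl⟩ := hΓ.2 f
    refine (map_smul (evalTens Γ Λ T T I (tensEquiv Γ Λ T _ x)) g LinearMap.id).trans ?_
    rw [hx, smul_zero, map_zero, map_zero]
    rfl
  · intro y
    let e : Γ ≃ₗ[Γ] (T →ₗ[Λᵐᵒᵖ] T) := LinearEquiv.ofBijective
      { toFun g := leftMul Λ T g
        map_add' a b := LinearMap.ext fun t => add_smul a b t
        map_smul' a b := LinearMap.ext fun t => mul_smul a b t } hΓ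
    obtain ⟨x, hx⟩ := hb.2 (LinearMap.toSpanSingleton Γ I y ∘ₗ e.symm.toLinearMap)
    obtain ⟨x, rfl⟩ := (tensEquiv Γ Λ T _).surjective x
    refine ⟨x, (key x).trans ?_⟩
    rw [hx]
    have h1 : e.symm LinearMap.id = 1 := by
      rw [LinearEquiv.symm_apply_eq]
      exact LinearMap.ext fun t => (one_smul Γ t).symm
    change e.symm LinearMap.id • y = y
    rw [h1, one_smul]

end Counit

/-! ### Modules on which the syzygies of `T` are flat -/

section LeftAcyclic

variable {Γ Λ : Type u} [Ring Γ] [Ring Λ]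
variable (T : Type u) [AddCommGroup T] [Module Γ T] [Module Λᵐᵒᵖ T] [SMulCommClass Γ Λᵐᵒᵖ T]
open Abelian

/-- The left modules `M` such that `- ⊗_Λ M` preserves the injectivity of the inclusion of
each syzygy of a right module without higher extensions by `T`. -/
def leftAcyclic : ObjectProperty (ModuleCat.{u} Λ) := fun M =>
  ∀ ⦃S S' S'' : ModuleCat.{u} Λᵐᵒᵖ⦄ ⦃i : S ⟶ S'⦄ ⦃p : S' ⟶ S''⦄ (w : i ≫ p = 0),
    (ShortComplex.mk i p w).ShortExact → HasFGSyzygies S → Projective S' →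
    Ext.rightAcyclic.{u} S'' (ModuleCat.of Λᵐᵒᵖ T) → Function.Injective (gMapLeft M i.hom)

variable {T}

lemma leftAcyclic_of_retract {M M' : ModuleCat.{u} Λ} (j : M ⟶ M') (r : M' ⟶ M) (h : j ≫ r = 𝟙 M)
    (hM : leftAcyclic T M') : leftAcyclic T M := by
  intro S S' S'' i p w hE hS hS' hT
  refine (injective_iff_map_eq_zero _).2 fun x hx => ?_
  have h1 : gMapRight S j.hom x = 0 := hM w hE hS hS' hT (by
    rw [← gMapRight_gMapLeft, hx, map_zero, map_zero])
  have h2 : gMapRight S r.hom (gMapRight S j.hom x) = x := by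
    rw [gMapRight_comp, ← ModuleCat.hom_comp, h, ModuleCat.hom_id, gMapRight_id]
  rw [← h2, h1, map_zero]

instance : (leftAcyclic (Λ := Λ) T).IsClosedUnderIsomorphisms where
  of_iso e hX := leftAcyclic_of_retract e.inv e.hom e.inv_hom_id hX

lemma leftAcyclic_biprod {M M' : ModuleCat.{u} Λ} (hM : leftAcyclic T M) (hM' : leftAcyclic T M') :
    leftAcyclic T (M ⊞ M') := by
  intro S S' S'' i p w hE hS hS' hT
  refine (injective_iff_map_eq_zero _).2 fun x hx => ?_
  have h1 : gMapRight S (Limits.biprod.fst : M ⊞ M' ⟶ M).hom x = 0 := hM w hE hS hS' hT (by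
    rw [← gMapRight_gMapLeft, hx, map_zero, map_zero])
  have h2 : gMapRight S (Limits.biprod.snd : M ⊞ M' ⟶ M').hom x = 0 := hM' w hE hS hS' hT (by
    rw [← gMapRight_gMapLeft, hx, map_zero, map_zero])
  have h3 : gMapRight S (Limits.biprod.inl : M ⟶ M ⊞ M').hom
      (gMapRight S (Limits.biprod.fst : M ⊞ M' ⟶ M).hom x) +
      gMapRight S (Limits.biprod.inr : M' ⟶ M ⊞ M').hom
      (gMapRight S (Limits.biprod.snd : M ⊞ M' ⟶ M').hom x) = x := by
    rw [gMapRight_comp, gMapRight_comp, ← gMapRight_add, ← ModuleCat.hom_comp,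
      ← ModuleCat.hom_comp, ← ModuleCat.hom_add, Limits.biprod.total, ModuleCat.hom_id,
      gMapRight_id]
  rw [← h3, h1, h2, map_zero, map_zero, add_zero]

lemma leftAcyclic_of_projective (M : ModuleCat.{u} Λ) (hM : Projective M) : leftAcyclic T M := by
  intro S S' S'' i p w hE hS hS' hT
  have := (IsProjective.iff_projective M).2 hM
  exact gMapLeft_injective_of_projective hE.moduleCat_injective_f

/-- Ext¹(S'', T) = 0 lets maps into T extend from S to S', while Ext²(S'', T) = 0 gives Ext¹(S, T) =
0, which makes the evaluation map for S injective. -/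
lemma leftAcyclic_homFunctor_obj (I : ModuleCat.{u} Γ) (hI : Injective I) :
    leftAcyclic T ((homFunctor Γ Λ T).obj I) := by
  intro S S' S'' i p w hE hS hS' hT
  have := SMulCommClass.symm Γ Λᵐᵒᵖ T
  have := Module.injective_module_of_injective_object Γ I
  exact gMapLeft_homs_injective (precomp_surjective (Γ := Γ) hE (hT 1 one_pos))
    (hS.evalTens_bijective (hE.subsingleton_ext_pred (hT 2 two_pos)) I).1

/-- Induction on the projective dimension of S. The class `leftAcyclic` makes 0 → S₁ ⊗ K → Q ⊗ K → S
⊗ K → 0 exact in each degree; the first two complexes are exact, by induction and by flatness of Q,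
hence so is the third. -/
lemma exists_gMapRight_d_eq {K : CochainComplex (ModuleCat.{u} Λ) ℤ} (hK : K.Acyclic)
    (hKT : ∀ n, leftAcyclic T (K.X n)) (e : ℕ) : ∀ (S : ModuleCat.{u} Λᵐᵒᵖ), HasFGSyzygies S →
      Ext.rightAcyclic.{u} S (ModuleCat.of Λᵐᵒᵖ T) → HasProjectiveDimensionLT S (e + 1) →
      ∀ (l m n : ℤ), l + 1 = m → m + 1 = n → ∀ (x : GroupTens Λ S (K.X m)),
        gMapRight S (K.d m n).hom x = 0 → ∃ y, gMapRight S (K.d l m).hom y = x := by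
  have hex (l m n : ℤ) (hl : l + 1 = m) (hn : m + 1 = n) :
      Function.Exact (K.d l m).hom (K.d m n).hom := by
    have h1 := (K.exactAt_iff' l m n (by simp [← hl]) (by simp [hn])).1 (hK m)
    exact (ShortComplex.ShortExact.moduleCat_exact_iff_function_exact _).1 h1
  induction e with
  | zero =>
    intro S hS _ hd l m n hl hn x hx
    have := hS.finite
    have := (IsProjective.iff_projective S).2 ((projective_iff_hasProjectiveDimensionLT_one).2 hd)
    exact exists_gMapRight_eq (hex l m n hl hn) x hx
  | succ e ih =>
    intro S hS hST hd l m n hl hn x hx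
    obtain ⟨S₁, Q, i, p, w, hS₁, hE, hQ, hQ'⟩ := hS.exists_syzygy
    have := (IsProjective.iff_projective Q).2 hQ'
    have hp := hE.moduleCat_surjective_g
    have hip := (ShortComplex.ShortExact.moduleCat_exact_iff_function_exact _).1 hE.exact
    have hinj (n : ℤ) := hKT n w hE hS₁ hQ' hST
    have hzero (a b c : ℤ) (X : ModuleCat.{u} Λᵐᵒᵖ) (x : GroupTens Λ X (K.X a)) :
        gMapRight X (K.d b c).hom (gMapRight X (K.d a b).hom x) = 0 := by
      rw [gMapRight_comp, ← ModuleCat.hom_comp, K.d_comp_d, ModuleCat.hom_zero, gMapRight_zero]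
    obtain ⟨x, rfl⟩ := gMapLeft_surjective hp x
    rw [gMapRight_gMapLeft] at hx
    obtain ⟨z, hz⟩ := exists_gMapLeft_eq hp hip _ hx
    -- The element z is a cycle, since its differential maps to d d x = 0 in Q ⊗ Kⁿ⁺¹ and that map
    -- is injective. So z is a boundary dy, and correcting the lift x by the image of y gives a
    -- cycle over Q.
    obtain ⟨y, rfl⟩ := ih S₁ hS₁ (fun j hj => by
        obtain ⟨j, rfl⟩ : ∃ k, j = k + 1 := ⟨j - 1, by omega⟩
        exact hE.subsingleton_ext_pred (hST (j + 2) (by omega)))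
      ((hE.hasProjectiveDimensionLT_X₃_iff e hQ').1 hd) m n (n + 1) hn rfl z
      (hinj (n + 1) (by rw [← gMapRight_gMapLeft, hz, hzero, map_zero]))
    obtain ⟨v, hv⟩ := exists_gMapRight_eq (S := Q) (hex l m n hl hn) (x - gMapLeft _ i.hom y) (by
      rw [map_sub, gMapRight_gMapLeft, hz, sub_self])
    refine ⟨gMapLeft _ p.hom v, ?_⟩
    rw [gMapRight_gMapLeft, hv, map_sub, gMapLeft_comp,
      show p.hom ∘ₗ i.hom = 0 from hip.linearMap_comp_eq_zero, gMapLeft_zero, sub_zero]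

lemma tensorFunctor_acyclic (hT : HasFGSyzygies (ModuleCat.of Λᵐᵒᵖ T))
    (hext : Ext.rightAcyclic.{u} (ModuleCat.of Λᵐᵒᵖ T) (ModuleCat.of Λᵐᵒᵖ T))
    {d : ℕ} [hd : HasProjectiveDimensionLT (ModuleCat.of Λᵐᵒᵖ T) (d + 1)]
    (K : CochainComplex (ModuleCat.{u} Λ) ℤ) (hK : K.Acyclic)
    (hKT : ∀ n, leftAcyclic T (K.X n)) :
    (((tensorFunctor Γ Λ T).mapHomologicalComplex _).obj K).Acyclic := by
  intro n
  rw [HomologicalComplex.exactAt_iff' _ (n - 1) n (n + 1) (by simp) (by simp),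
    ShortComplex.moduleCat_exact_iff]
  intro (x : Tens Γ Λ T (K.X n)) (hx : tensMap Γ Λ T (K.d n (n + 1)).hom x = 0)
  obtain ⟨y, hy⟩ := exists_gMapRight_d_eq hK hKT d _ hT hext hd (n - 1) n (n + 1) (by simp) rfl
    (tensEquiv Γ Λ T _ x) (by
      refine (tensEquiv_tensMap Γ Λ T (K.d n (n + 1)).hom x).symm.trans ?_
      rw [hx, map_zero])
  obtain ⟨y, rfl⟩ := (tensEquiv Γ Λ T _).surjective y
  refine ⟨y, (tensEquiv Γ Λ T _).injective ?_⟩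
  exact (tensEquiv_tensMap Γ Λ T (K.d (n - 1) n).hom y).trans hy

end LeftAcyclic

/-! ### The Wakamatsu tilting conditions imply the conditions on the adjunction -/

section Derives

variable {Γ Λ : Type u} [Ring Γ] [Ring Λ]
variable {T : Type u} [AddCommGroup T] [Module Γ T] [Module Λᵐᵒᵖ T] [SMulCommClass Γ Λᵐᵒᵖ T]

/-- The bijections Λ → End_Γ(T) and Γ → End_Λᵒ(T) govern the unit and the counit; the vanishing of
Extⁱ(T, T) on both sides governs the two classes; finite projective dimension gives acyclicity. -/
lemma IsWakamatsuTilting.derivesToEquivalence (hT : IsWakamatsuTilting Γ Λ T)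
    (hpdΓ : projectiveDimension (ModuleCat.of Γ T) ≠ ⊤)
    (hpdΛ : projectiveDimension (ModuleCat.of Λᵐᵒᵖ T) ≠ ⊤) :
    DerivesToEquivalence (tensHomAdj Γ Λ T) (leftAcyclic T)
      (Abelian.Ext.rightAcyclic.{u} (ModuleCat.of Γ T)) := by
  obtain ⟨d, hd⟩ := (projectiveDimension_ne_top_iff _).1 hpdΓ
  obtain ⟨d', hd'⟩ := (projectiveDimension_ne_top_iff _).1 hpdΛ
  have hl := hT.resolution_left.hasFGSyzygies
  have hr := hT.resolution_right.hasFGSyzygies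
  exact {
    isIso_unit P hP := isIso_unit_app P hl.finite hT.homothety_right hP
    isIso_counit I hI := isIso_counit_app hr (hT.ext_right 1 one_pos) hT.homothety_left I hI
    iso_left := inferInstance
    biprod_left _ _ := leftAcyclic_biprod
    projective_left := leftAcyclic_of_projective
    map_left := leftAcyclic_homFunctor_obj
    acyclic_left K := tensorFunctor_acyclic (d := d') hr hT.ext_right K
    iso_right := inferInstance
    biprod_right _ _ := Abelian.Ext.rightAcyclic_biprod
    injective_right := Abelian.Ext.rightAcyclic_of_injective _
    map_right P hP := rightAcyclic_tensorFunctor_obj P hl hT.ext_left hP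
    acyclic_right K := homFunctor_acyclic Γ Λ T (d := d + 1) K }

end Derives

end Bimod

end

noncomputable section

namespace Bimod

/-! ### Finitely generated modules over noetherian rings -/

section Noetherian

variable {R : Type u} [Ring R]

/-- The syzygy sequences are spliced: the differential is the composite Qₙ₊₁ ⟶ Sₙ₊₁ ⟶ Qₙ. -/
lemma HasFGSyzygies.exists_projectiveResolution {M : ModuleCat.{u} R} (h : HasFGSyzygies M) :
    ∃ P : ProjectiveResolution M, ∀ n : ℕ, Module.Finite R (P.complex.X n) := by
  obtain ⟨S, ⟨e⟩, h⟩ := h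
  choose Q f g w hE hQ hQ' using h
  let K : ChainComplex (ModuleCat.{u} R) ℕ := ChainComplex.of Q (fun n => g (n + 1) ≫ f n)
    fun n => by rw [Category.assoc, reassoc_of% (w (n + 1)), Limits.zero_comp, Limits.comp_zero]
  have hd (n : ℕ) : K.d (n + 1) n = g (n + 1) ≫ f n :=
    ChainComplex.of_d Q (fun n => g (n + 1) ≫ f n) n
  have hf (n : ℕ) : Function.Injective (f n) := (hE n).moduleCat_injective_f
  have hg (n : ℕ) : Function.Surjective (g n) := (hE n).moduleCat_surjective_g
  have hfg (n : ℕ) : Function.Exact (f n) (g n) :=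
    (ShortComplex.ShortExact.moduleCat_exact_iff_function_exact _).1 (hE n).exact
  have hw : K.d 1 0 ≫ g 0 ≫ e.hom = 0 := by
    rw [hd, Category.assoc, reassoc_of% (w 0), Limits.zero_comp, Limits.comp_zero]
  refine ⟨{ complex := K
            projective := hQ'
            π := (ChainComplex.toSingle₀Equiv _ _).symm ⟨g 0 ≫ e.hom, hw⟩
            quasiIso := ⟨fun n => ?_⟩ }, hQ⟩
  obtain - | n := n
  · rw [ChainComplex.quasiIsoAt₀_iff, ShortComplex.quasiIso_iff_of_zeros' _ rfl rfl rfl]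
    have h0 : (ShortComplex.mk (K.d 1 0) (g 0 ≫ e.hom) hw).Exact := by
      rw [ShortComplex.moduleCat_exact_iff]
      intro x hx
      have hx' : g 0 x = 0 := (ConcreteCategory.bijective_of_isIso e.hom).1 (by
        rw [map_zero]; exact hx)
      obtain ⟨y, rfl⟩ := (hfg 0 x).1 hx'
      obtain ⟨z, rfl⟩ := hg 1 y
      exact ⟨z, ConcreteCategory.congr_hom (hd 0) z⟩
    have : Epi (g 0) := (ModuleCat.epi_iff_surjective _).2 (hg 0)
    refine (ShortComplex.exact_and_epi_g_iff_of_iso ?_).2 ⟨h0, by dsimp; infer_instance⟩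
    exact ShortComplex.isoMk (Iso.refl _) (Iso.refl _) (Iso.refl _)
      ((Category.id_comp _).trans (Category.comp_id _).symm)
      ((Category.id_comp _).trans (Category.comp_id _).symm)
  · rw [quasiIsoAt_iff_exactAt' _ _ (ChainComplex.exactAt_succ_single_obj _ _),
      HomologicalComplex.exactAt_iff' _ (n + 1 + 1) (n + 1) n (by simp) (by simp),
      ShortComplex.moduleCat_exact_iff]
    intro (x : Q (n + 1)) (hx : K.d (n + 1) n x = 0)
    rw [hd] at hx
    have hx' : g (n + 1) x = 0 := hf n (by rw [map_zero]; exact hx)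
    obtain ⟨y, rfl⟩ := (hfg (n + 1) x).1 hx'
    obtain ⟨z, rfl⟩ := hg (n + 2) y
    refine ⟨z, ?_⟩
    change K.d (n + 1 + 1) (n + 1) z = _
    rw [hd]
    rfl

lemma hasFGSyzygies_of_finite [IsNoetherianRing R] (M : ModuleCat.{u} R) (hM : Module.Finite R M) :
    HasFGSyzygies M := by
  have key (M : ModuleCat.{u} R) (hM : Module.Finite R M) : ∃ (S Q : ModuleCat.{u} R) (f : S ⟶ Q)
      (g : Q ⟶ M) (w : f ≫ g = 0), Module.Finite R S ∧ (ShortComplex.mk f g w).ShortExact ∧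
        Module.Finite R Q ∧ Projective Q := by
    obtain ⟨n, p, hp⟩ := Module.Finite.exists_fin' R M
    refine ⟨ModuleCat.of R (LinearMap.ker p), ModuleCat.of R (Fin n → R),
      ModuleCat.ofHom (LinearMap.ker p).subtype, ModuleCat.ofHom p,
      ModuleCat.hom_ext (LinearMap.comp_ker_subtype p), inferInstanceAs
        (Module.Finite R (LinearMap.ker p)),
      ?_, inferInstanceAs (Module.Finite R (Fin n → R)), (IsProjective.iff_projective _).1
        (inferInstanceAs (Module.Projective R (Fin n → R)))⟩
    refine ShortComplex.ShortExact.mk' ?_ ?_ ?_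
    · rw [ShortComplex.ShortExact.moduleCat_exact_iff_function_exact]
      exact LinearMap.exact_subtype_ker_map p
    · exact (ModuleCat.mono_iff_injective _).2 (Submodule.injective_subtype _)
    · exact (ModuleCat.epi_iff_surjective _).2 hp
  choose S Q f g w hS hE hQ hQ' using key
  let s : ℕ → {M : ModuleCat.{u} R // Module.Finite R M} := fun n =>
    Nat.rec ⟨M, hM⟩ (fun _ M => ⟨S M.1 M.2, hS M.1 M.2⟩) n
  exact ⟨fun n => (s n).1, ⟨Iso.refl _⟩, fun n => ⟨Q _ (s n).2, f _ (s n).2, g _ (s n).2,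
    w _ (s n).2, hE _ (s n).2, hQ _ (s n).2, hQ' _ (s n).2⟩⟩

lemma IsArtinAlgebra.isNoetherianRing (h : IsArtinAlgebra R) : IsNoetherianRing R := by
  obtain ⟨k, _, _, _, _⟩ := h
  exact isNoetherian_of_tower k (inferInstanceAs (IsNoetherian k R))

lemma finite_of_iso {M N : ModuleCat.{u} R} (e : M ≅ N) (hM : Module.Finite R M) :
    Module.Finite R N :=
  Module.Finite.equiv e.toLinearEquiv

lemma finite_homology_of_isNoetherian (S : ShortComplex (ModuleCat.{u} R))
    (h : IsNoetherian R S.X₂) : Module.Finite R S.homology :=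
  finite_of_iso S.moduleCatHomologyIso.symm (inferInstanceAs
    (Module.Finite R (LinearMap.ker S.g.hom ⧸ LinearMap.range S.moduleCatToCycles)))

/-- A homology module is finitely generated if finitely many cycles generate all cycles
up to boundaries. -/
lemma finite_homology_of_cycles (S : ShortComplex (ModuleCat.{u} R)) {m : ℕ} (z : Fin m → S.X₂)
    (hz : ∀ i, S.g (z i) = 0) (h : ∀ x, S.g x = 0 → ∃ (c : Fin m → R) (y : S.X₁),
      x = ∑ i, c i • z i + S.f y) : Module.Finite R S.homology := by
  refine finite_of_iso S.moduleCatHomologyIso.symm ?_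
  let q : LinearMap.ker S.g.hom →ₗ[R]
    (LinearMap.ker S.g.hom ⧸ LinearMap.range S.moduleCatToCycles) := Submodule.mkQ _
  let z' (i : Fin m) : LinearMap.ker S.g.hom := ⟨z i, hz i⟩
  have hs : Function.Surjective (Fintype.linearCombination R fun i => q (z' i)) := by
    intro x
    obtain ⟨⟨x, hx⟩, rfl⟩ := Submodule.mkQ_surjective _ x
    obtain ⟨c, y, hy⟩ := h x hx
    refine ⟨c, ?_⟩
    rw [Fintype.linearCombination_apply]
    have h1 : ∑ i, c i • q (z' i) = q (∑ i, c i • z' i) := by simp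
    rw [h1]
    refine (Submodule.Quotient.eq _).2 ⟨-y, Subtype.ext ?_⟩
    simp [z', hy]
    rfl
  exact Module.Finite.of_surjective _ hs

end Noetherian

/-! ### Finite generation of Tor -/

section Tor

variable {Γ Λ : Type u} [Ring Γ] [Ring Λ]
variable {T : Type u} [AddCommGroup T] [Module Γ T] [Module Λᵐᵒᵖ T] [SMulCommClass Γ Λᵐᵒᵖ T]

lemma finite_tens (M : Type u) [AddCommGroup M] [Module Λ M] [Module.Finite Γ T]
    [Module.Finite Λ M] : Module.Finite Γ (Tens Γ Λ T M) := by
  obtain ⟨s, hs⟩ := Module.Finite.fg_top (R := Λ) (M := M)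
  have key : ⨆ m : s, LinearMap.range (tmkHom Γ T (Λ := Λ) (m : M)) = ⊤ := by
    set N := ⨆ m : s, LinearMap.range (tmkHom Γ T (Λ := Λ) (m : M)) with hN
    have h1 (m : M) : ∀ t : T, tmk Γ Λ t m ∈ N := by
      have hm : m ∈ Submodule.span Λ (s : Set M) := hs ▸ Submodule.mem_top
      induction hm using Submodule.span_induction with
      | mem m hm =>
        exact fun t => Submodule.mem_iSup_of_mem (⟨m, hm⟩ : s) ⟨t, rfl⟩
      | zero =>
        intro t
        have : tmk Γ Λ t (0 : M) = 0 := by simp [tmk]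
        rw [this]
        exact zero_mem _
      | add m m' _ _ h h' =>
        intro t
        rw [tmk_add]
        exact add_mem (h t) (h' t)
      | smul l m _ h =>
        intro t
        rw [← op_smul_tmk]
        exact h _
    refine eq_top_iff.2 fun x _ => ?_
    obtain ⟨y, rfl⟩ := Submodule.Quotient.mk_surjective _ x
    induction y using TensorProduct.induction_on with
    | zero => exact zero_mem _
    | tmul t m => exact h1 m t
    | add a b ha hb => exact add_mem (ha trivial) (hb trivial)
  refine ⟨?_⟩
  rw [← key]
  exact Submodule.fg_iSup _ fun m => Module.Finite.iff_fg.1 inferInstance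

/-- Over noetherian Λ the resolution can be taken with finitely generated terms; then Tor is a
subquotient of a finitely generated module over the noetherian ring Γ. -/
lemma finite_leftDerived [IsNoetherianRing Γ] [IsNoetherianRing Λ] [Module.Finite Γ T]
    (M : ModuleCat.{u} Λ) (hM : Module.Finite Λ M) (n : ℕ) :
    Module.Finite Γ (((tensorFunctor Γ Λ T).leftDerived n).obj M) := by
  obtain ⟨P, hP⟩ := (hasFGSyzygies_of_finite M hM).exists_projectiveResolution
  refine finite_of_iso (P.isoLeftDerivedObj _ n).symm (finite_homology_of_isNoetherian _ ?_)
  have := hP n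
  have := finite_tens (Γ := Γ) (Λ := Λ) (T := T) (P.complex.X n)
  exact isNoetherian_of_isNoetherianRing_of_finite Γ (Tens Γ Λ T (P.complex.X n))

end Tor

/-! ### Finite generation of Ext -/

section Ext

variable {Γ : Type u} [Ring Γ] {k : Type u} [CommRing k] [Algebra k Γ]

variable (Γ) in
/-- The multiplication by an element of `k`, as a `Γ`-linear map. -/
def centralMul (S : Type*) [AddCommGroup S] [Module Γ S] (c : k) : S →ₗ[Γ] S where
  toFun s := algebraMap k Γ c • s
  map_add' := smul_add _
  map_smul' a s := by rw [RingHom.id_apply, ← mul_smul, ← mul_smul, Algebra.commutes]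

lemma comp_centralMul {S N : Type*} [AddCommGroup S] [Module Γ S] [AddCommGroup N] [Module Γ N]
    (f : S →ₗ[Γ] N) (c : k) : f ∘ₗ centralMul Γ S c = centralMul Γ N c ∘ₗ f :=
  LinearMap.ext fun s => map_smul f (algebraMap k Γ c) s

lemma sum_comp {S S' N : Type*} [AddCommGroup S] [Module Γ S] [AddCommGroup S'] [Module Γ S']
    [AddCommGroup N] [Module Γ N] {m : ℕ} (f : Fin m → S' →ₗ[Γ] N) (g : S →ₗ[Γ] S') :
    (∑ i, f i) ∘ₗ g = ∑ i, f i ∘ₗ g :=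
  LinearMap.ext fun x => by simp [LinearMap.sum_apply]

lemma comp_sum {S S' N : Type*} [AddCommGroup S] [Module Γ S] [AddCommGroup S'] [Module Γ S']
    [AddCommGroup N] [Module Γ N] {m : ℕ} (f : S' →ₗ[Γ] N) (g : Fin m → S →ₗ[Γ] S') :
    f ∘ₗ ∑ i, g i = ∑ i, f ∘ₗ g i :=
  LinearMap.ext fun x => by simp [LinearMap.sum_apply]

/-- Finitely many maps generate `Hom_Γ(S, N)` over `k`. -/
lemma exists_generators_hom [IsNoetherianRing k] [Module.Finite k Γ] (S N : Type u)
    [AddCommGroup S] [Module Γ S] [Module.Finite Γ S] [AddCommGroup N] [Module Γ N]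
    [Module.Finite Γ N] : ∃ (m : ℕ) (F : Fin m → S →ₗ[Γ] N), ∀ f : S →ₗ[Γ] N,
      ∃ c : Fin m → k, f = ∑ i, F i ∘ₗ centralMul Γ S (c i) := by
  let _ : Module k N := Module.compHom N (algebraMap k Γ)
  have : IsScalarTower k Γ N := ⟨fun c a x => by
    rw [Algebra.smul_def, mul_smul]
    rfl⟩
  have : SMulCommClass Γ k N := ⟨fun a c x => by
    change a • algebraMap k Γ c • x = algebraMap k Γ c • a • x
    rw [← mul_smul, ← mul_smul, Algebra.commutes]⟩
  have : Module.Finite k N := Module.Finite.trans Γ N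
  obtain ⟨r, s, hs⟩ := Module.Finite.exists_fin (R := Γ) (M := S)
  -- Values on r generators of S embed Hom_Γ(S, N) in Nʳ, which is noetherian over k.
  let ev : (S →ₗ[Γ] N) →ₗ[k] (Fin r → N) :=
    { toFun f j := f (s j)
      map_add' _ _ := rfl
      map_smul' _ _ := rfl }
  have hev : Function.Injective ev := fun f g hfg =>
    LinearMap.ext_on_range hs fun j => congrFun hfg j
  have : IsNoetherian k (S →ₗ[Γ] N) := isNoetherian_of_injective ev hev
  obtain ⟨m, F, hF⟩ := Module.Finite.exists_fin (R := k) (M := S →ₗ[Γ] N)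
  refine ⟨m, F, fun f => ?_⟩
  obtain ⟨c, rfl⟩ := (Submodule.mem_span_range_iff_exists_fun k).1
    (hF ▸ Submodule.mem_top : f ∈ Submodule.span k (Set.range F))
  refine ⟨c, Finset.sum_congr rfl fun i _ => LinearMap.ext fun x => ?_⟩
  exact (map_smul (F i) (algebraMap k Γ (c i)) x).symm

/-- In a complex of injective modules which is exact in positive degrees and has finitely generated
cycles in degree zero, finitely many maps `S → J^n` generate over `k` all maps into the cycles,
up to maps which lift along the differential. -/
lemma exists_generators_cocycles [IsNoetherianRing k] [Module.Finite k Γ]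
    (J : CochainComplex (ModuleCat.{u} Γ) ℤ) (hJ : ∀ i, Injective (J.X i))
    (hex : ∀ i : ℤ, 0 < i → J.ExactAt i)
    (hfin : Module.Finite Γ (LinearMap.ker (J.d 0 1).hom)) (n : ℕ) :
    ∀ (S : Type u) [AddCommGroup S] [Module Γ S] [Module.Finite Γ S] (a b c : ℤ),
      b = n → a + 1 = b → b + 1 = c →
      ∃ (m : ℕ) (F : Fin m → S →ₗ[Γ] J.X b), (∀ i, (J.d b c).hom ∘ₗ F i = 0) ∧
        ∀ f : S →ₗ[Γ] J.X b, (J.d b c).hom ∘ₗ f = 0 →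
          ∃ (l : Fin m → k) (g : S →ₗ[Γ] J.X a),
            f = ∑ i, F i ∘ₗ centralMul Γ S (l i) + (J.d a b).hom ∘ₗ g := by
  have hinj (i : ℤ) := Module.injective_module_of_injective_object Γ (J.X i)
  have hdd (a b c : ℤ) : (J.d b c).hom ∘ₗ (J.d a b).hom = 0 := by
    rw [← ModuleCat.hom_comp, J.d_comp_d, ModuleCat.hom_zero]
  induction n with
  | zero =>
    intro S _ _ _ a b c hb ha hc
    obtain rfl : b = 0 := hb
    obtain rfl : c = 1 := by omega
    -- In degree zero a cocycle is a map into the finitely generated kernel of the first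
    -- differential.
    obtain ⟨m, F, hF⟩ := exists_generators_hom (Γ := Γ) (k := k) S (LinearMap.ker (J.d 0 1).hom)
    refine ⟨m, fun i => Submodule.subtype _ ∘ₗ F i, fun i => LinearMap.ext fun s => (F i s).2,
      fun f hf => ?_⟩
    obtain ⟨l, hl⟩ := hF (f.codRestrict _ fun s => LinearMap.congr_fun hf s)
    refine ⟨l, 0, LinearMap.ext fun s => ?_⟩
    have := congrArg Subtype.val (LinearMap.congr_fun hl s)
    refine Eq.trans this ?_
    simp [LinearMap.sum_apply]
  | succ n ih =>
    intro S _ _ _ a b c hb ha hc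
    obtain ⟨r, p, hp⟩ := Module.Finite.exists_fin' Γ S
    have : IsNoetherian k Γ := inferInstance
    have : IsNoetherianRing Γ := isNoetherian_of_tower k this
    let i : LinearMap.ker p →ₗ[Γ] (Fin r → Γ) := Submodule.subtype _
    have hip : p ∘ₗ i = 0 := LinearMap.comp_ker_subtype p
    have hdesc {X : ModuleCat.{u} Γ} (h : (Fin r → Γ) →ₗ[Γ] X) (hh : h ∘ₗ i = 0) :
        ∃ h' : S →ₗ[Γ] X, h' ∘ₗ p = h := by
      refine ⟨(LinearMap.ker p).liftQ h (fun x hx => LinearMap.congr_fun hh ⟨x, hx⟩) ∘ₗ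
        (p.quotKerEquivOfSurjective hp).symm.toLinearMap, LinearMap.ext fun x => ?_⟩
      have h1 : (p.quotKerEquivOfSurjective hp).symm (p x) = Submodule.Quotient.mk x := by
        rw [LinearEquiv.symm_apply_eq]
        rfl
      rw [LinearMap.comp_apply, LinearMap.comp_apply, LinearEquiv.coe_coe, h1]
      rfl
    have hext (j : ℤ) (h : LinearMap.ker p →ₗ[Γ] J.X j) :
        ∃ h' : (Fin r → Γ) →ₗ[Γ] J.X j, h' ∘ₗ i = h := by
      obtain ⟨h', hh⟩ := Module.Injective.out i (Submodule.injective_subtype _) h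
      exact ⟨h', LinearMap.ext hh⟩
    have hpc {X : ModuleCat.{u} Γ} {h h' : S →ₗ[Γ] X} (e : h ∘ₗ p = h' ∘ₗ p) : h = h' :=
      (LinearMap.cancel_right hp).1 e
    -- Dimension shifting in the first variable, over the noetherian ring Γ. Generators on the
    -- kernel of Γʳ → S extend to maps H on Γʳ since the terms of J are injective; the maps d H
    -- vanish on the kernel and descend to the generators E on S.
    obtain ⟨m, F, hF, hF'⟩ := ih (LinearMap.ker p) (a - 1) a b (by omega) (by omega) ha
    choose H hH using fun j => hext a (F j)
    choose E hE using fun j => hdesc ((J.d a b).hom ∘ₗ H j) (by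
      rw [LinearMap.comp_assoc, hH, hF])
    refine ⟨m, E, fun j => hpc ?_, fun f hf => ?_⟩
    · rw [LinearMap.comp_assoc, hE, ← LinearMap.comp_assoc, hdd, LinearMap.zero_comp,
        LinearMap.zero_comp]
    have hab : Function.Exact (J.d a b).hom (J.d b c).hom :=
      (ShortComplex.ShortExact.moduleCat_exact_iff_function_exact _).1
        ((J.exactAt_iff' a b c (by simp [← ha]) (by simp [hc])).1 (hex b (by omega)))
    -- The cocycle f p lifts along d because Γʳ is projective and J is exact in this positive
    -- degree.
    obtain ⟨h, hh⟩ : ∃ h : (Fin r → Γ) →ₗ[Γ] J.X a, (J.d a b).hom ∘ₗ h = f ∘ₗ p := by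
      obtain ⟨h, hh⟩ := Module.projective_lifting_property
        ((J.d a b).hom.codRestrict (LinearMap.ker (J.d b c).hom)
          fun x => LinearMap.congr_fun (hdd a b c) x)
        ((f ∘ₗ p).codRestrict (LinearMap.ker (J.d b c).hom)
          fun x => LinearMap.congr_fun hf (p x)) (fun ⟨x, hx⟩ => by
            obtain ⟨y, hy⟩ := (hab x).1 hx
            exact ⟨y, Subtype.ext hy⟩)
      exact ⟨h, LinearMap.ext fun x => congrArg Subtype.val (LinearMap.congr_fun hh x)⟩
    obtain ⟨l, g, hg⟩ := hF' (h ∘ₗ i) (by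
      rw [← LinearMap.comp_assoc, hh, LinearMap.comp_assoc, hip, LinearMap.comp_zero])
    obtain ⟨g, rfl⟩ := hext (a - 1) g
    -- Subtracting the generators and the boundary leaves a map that vanishes on the kernel, hence
    -- descends to v on S; applying d expresses f through E and d v.
    obtain ⟨v, hv⟩ := hdesc (h - ∑ j, H j ∘ₗ centralMul Γ _ (l j) - (J.d (a - 1) a).hom ∘ₗ g) (by
      rw [LinearMap.sub_comp, LinearMap.sub_comp, hg, sum_comp, LinearMap.comp_assoc]
      have : ∑ j, (H j ∘ₗ centralMul Γ _ (l j)) ∘ₗ i = ∑ j, F j ∘ₗ centralMul Γ _ (l j) :=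
        Finset.sum_congr rfl fun j _ => by
          rw [LinearMap.comp_assoc, ← comp_centralMul, ← LinearMap.comp_assoc, hH]
      rw [this]
      abel)
    refine ⟨l, v, hpc ?_⟩
    rw [LinearMap.add_comp, LinearMap.comp_assoc, hv, ← hh, LinearMap.comp_sub, LinearMap.comp_sub,
      ← LinearMap.comp_assoc, hdd, LinearMap.zero_comp, sub_zero, sum_comp]
    have : ∑ j, (E j ∘ₗ centralMul Γ S (l j)) ∘ₗ p =
        (J.d a b).hom ∘ₗ ∑ j, H j ∘ₗ centralMul Γ _ (l j) := by
      rw [comp_sum]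
      refine Finset.sum_congr rfl fun j _ => ?_
      rw [LinearMap.comp_assoc, ← comp_centralMul, ← LinearMap.comp_assoc, hE, LinearMap.comp_assoc]
    rw [this]
    abel

variable {Λ : Type u} [Ring Λ]
variable {T : Type u} [AddCommGroup T] [Module Γ T] [Module Λᵐᵒᵖ T] [SMulCommClass Γ Λᵐᵒᵖ T]

/-- The terms of an injective resolution need not be finitely generated, so finitely many cocycles
are shown to generate modulo coboundaries, first over k. Scalars of k act on T by Γ-endomorphisms,
that is, by right multiplication with elements of Λ, so the same cocycles generate over Λ. -/
lemma finite_rightDerived (hΓ : IsArtinAlgebra Γ) [Module.Finite Γ T]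
    (hΛ : Function.Bijective fun l : Λ => rightMul Γ T l)
    (N : ModuleCat.{u} Γ) (hN : Module.Finite Γ N) (n : ℕ) :
    Module.Finite Λ (((homFunctor Γ Λ T).rightDerived n).obj N) := by
  have := hΓ.isNoetherianRing
  obtain ⟨k, _, _, _, _⟩ := hΓ
  let J := injComplex 0 N
  have hJ0 (i : ℤ) (hi : i < 0) : Limits.IsZero (J.X i) :=
    HomologicalComplex.isZero_extend_X _ _ _ (by simp; omega)
  -- The resolution is zero in negative degrees, so its cycles in degree zero are its homology
  -- there, which is N.
  have hfin : Module.Finite Γ (LinearMap.ker (J.d 0 1).hom) := by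
    have h1 := finite_of_iso (injComplexHomologyIso 0 N).symm hN
    have h2 : IsIso (J.homologyπ 0) :=
      J.isIso_homologyπ (-1) 0 (by simp) ((hJ0 (-1) (by omega)).eq_of_src _ _)
    have h3 : Module.Finite Γ (J.cycles 0) := finite_of_iso (asIso (J.homologyπ 0)).symm h1
    have h4 : Function.Exact (J.iCycles 0).hom (J.d 0 1).hom :=
      (ShortComplex.ShortExact.moduleCat_exact_iff_function_exact _).1
        (ShortComplex.exact_of_f_is_kernel (ShortComplex.mk (J.iCycles 0) (J.d 0 1) (by simp))
          (J.cyclesIsKernel 0 1 (by simp)))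
    rw [h4.linearMap_ker_eq]
    exact Module.Finite.range _
  obtain ⟨m, F, hF, hF'⟩ := exists_generators_cocycles (k := k) J
    (injComplex_X_injective 0 N) (fun i hi => injComplex_exactOff 0 N i hi.ne') hfin n T
    (n - 1) n (n + 1) rfl (by simp) rfl
  choose l hl using fun c : k => hΛ.2 (centralMul Γ T c)
  refine finite_of_iso (rightDerivedIso (homFunctor Γ Λ T) 0 N (n := n) (i := n) (zero_add _)) ?_
  refine finite_of_iso (ShortComplex.homologyMapIso (HomologicalComplex.isoSc' _ (n - 1 : ℤ) n
    (n + 1) (by simp) (by simp))).symm ?_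
  refine finite_homology_of_cycles _ (m := m) (fun i => (F i : Homs Γ Λ T (J.X n))) hF ?_
  intro (f : Homs Γ Λ T (J.X n)) (hf : (J.d n (n + 1)).hom ∘ₗ f.toLin = 0)
  obtain ⟨c, g, hg⟩ := hF' f.toLin hf
  refine ⟨fun i => l (c i), g, hg.trans ?_⟩
  refine congrArg (· + (J.d (n - 1) n).hom ∘ₗ g) ?_
  have : ∑ i, F i ∘ₗ centralMul Γ T (c i) = ∑ i, F i ∘ₗ rightMul Γ T (l (c i)) :=
    Finset.sum_congr rfl fun i _ => congrArg (F i ∘ₗ ·) (hl (c i)).symm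
  exact this

end Ext

end Bimod

end

noncomputable section

namespace Bimod

/-! ### The equivalences in all degrees -/

/-- Serves negative ℓ: all the morphism sets involved have exactly one element, so the relation may
hold always. -/
lemma restrictsToAdjointEquivalence_of_isZero {C D : Type*} [Category* C] [Category* D]
    (F : C ⥤ D) (G : D ⥤ C) (P : ObjectProperty C) (Q : ObjectProperty D)
    (hP : ∀ X, P X → Limits.IsZero X) (hQ : ∀ Y, Q Y → Limits.IsZero Y)
    (hF : ∀ X, Limits.IsZero (F.obj X)) (hG : ∀ Y, Limits.IsZero (G.obj Y))
    (hFQ : ∀ X, P X → Q (F.obj X)) (hGP : ∀ Y, Q Y → P (G.obj Y)) :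
    RestrictsToAdjointEquivalence F G P Q :=
  restrictsToAdjointEquivalence_of_rel F G P Q (fun _ _ _ _ => True)
    (fun _ _ _ _ _ _ _ => trivial) (fun _ _ _ _ _ _ _ => trivial)
    (fun _ Y _ _ => ⟨(hG Y).from_ _, trivial⟩) (fun _ Y _ _ _ _ _ _ => (hG Y).eq_of_tgt _ _)
    (fun X _ _ _ => ⟨(hF X).to_ _, trivial⟩) (fun X _ _ _ _ _ _ _ => (hF X).eq_of_src _ _)
    hFQ hGP (fun X hX g _ => (hP X hX).isIso (hG _) g) (fun Y hY h _ => (hF _).isIso (hQ Y hY) h)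

variable {Γ Λ : Type u} [Ring Γ] [Ring Λ]
variable {T : Type u} [AddCommGroup T] [Module Γ T] [Module Λᵐᵒᵖ T] [SMulCommClass Γ Λᵐᵒᵖ T]

lemma isZero_punit (R : Type u) [Ring R] : Limits.IsZero (ModuleCat.of R PUnit.{u + 1}) :=
  ModuleCat.isZero_of_subsingleton _

lemma torConcentrated_ofNat_iff (ℓ : ℕ) (M : ModuleCat.{u} Λ) :
    torConcentrated Γ Λ T (Int.ofNat ℓ) M ↔
      ∀ n : ℕ, n ≠ ℓ → Limits.IsZero (((tensorFunctor Γ Λ T).leftDerived n).obj M) := by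
  refine ⟨fun h n hn => h (Int.ofNat n) (by simpa using hn), fun h i hi => ?_⟩
  obtain n | n := i
  · exact h n (by rintro rfl; exact hi rfl)
  · exact isZero_punit Γ

lemma extConcentrated_ofNat_iff (ℓ : ℕ) (N : ModuleCat.{u} Γ) :
    extConcentrated Γ Λ T (Int.ofNat ℓ) N ↔
      ∀ n : ℕ, n ≠ ℓ → Limits.IsZero (((homFunctor Γ Λ T).rightDerived n).obj N) := by
  refine ⟨fun h n hn => h (Int.ofNat n) (by simpa using hn), fun h i hi => ?_⟩
  obtain n | n := i
  · exact h n (by rintro rfl; exact hi rfl)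
  · exact isZero_punit Λ

lemma torConcentrated_of_isZero (ℓ : ℤ) {M : ModuleCat.{u} Λ} (hM : Limits.IsZero M) :
    torConcentrated Γ Λ T ℓ M := by
  intro i _
  obtain n | n := i
  · refine (Limits.IsZero.iff_id_eq_zero _).2 ?_
    rw [← CategoryTheory.Functor.map_id, hM.eq_of_src (𝟙 M) 0]
    refine (Functor.leftDerived_map_eq _ n 0 (P := projectiveResolution M)
      (Q := projectiveResolution M) (g := 0) (by simp)).trans ?_
    rw [Functor.map_zero, Limits.zero_comp, Limits.comp_zero]
    rfl
  · exact isZero_punit Γ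

lemma extConcentrated_of_isZero (ℓ : ℤ) {N : ModuleCat.{u} Γ} (hN : Limits.IsZero N) :
    extConcentrated Γ Λ T ℓ N := by
  intro i _
  obtain n | n := i
  · refine (Limits.IsZero.iff_id_eq_zero _).2 ?_
    rw [← CategoryTheory.Functor.map_id, hN.eq_of_src (𝟙 N) 0]
    refine (Functor.rightDerived_map_eq _ n 0 (P := injectiveResolution N)
      (Q := injectiveResolution N) (g := 0) (by simp)).trans ?_
    rw [Functor.map_zero, Limits.zero_comp, Limits.comp_zero]
    rfl
  · exact isZero_punit Λ

variable {V : ObjectProperty (ModuleCat.{u} Λ)} {W : ObjectProperty (ModuleCat.{u} Γ)}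
  (hd : DerivesToEquivalence (tensHomAdj Γ Λ T) V W)

include hd

/-- The equivalence between the concentrated modules which lie in given classes `P` and `Q` that
contain the zero modules and are stable under the derived functors. -/
lemma restrictsToAdjointEquivalence_concentrated (P : ObjectProperty (ModuleCat.{u} Λ))
    (Q : ObjectProperty (ModuleCat.{u} Γ)) (hP : ∀ M, Limits.IsZero M → P M)
    (hQ : ∀ N, Limits.IsZero N → Q N)
    (hF : ∀ (n : ℕ) M, P M → Q (((tensorFunctor Γ Λ T).leftDerived n).obj M))
    (hG : ∀ (n : ℕ) N, Q N → P (((homFunctor Γ Λ T).rightDerived n).obj N)) (ℓ : ℤ) :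
    RestrictsToAdjointEquivalence (torFunctor Γ Λ T ℓ) (extFunctor Γ Λ T ℓ)
      (P ⊓ torConcentrated Γ Λ T ℓ) (Q ⊓ extConcentrated Γ Λ T ℓ) := by
  obtain ℓ | ℓ := ℓ
  · refine hd.restrictsToAdjointEquivalence (ℓ := ℓ) _ _
      (fun M hM => (torConcentrated_ofNat_iff ℓ M).1 hM.2)
      (fun N hN => (extConcentrated_ofNat_iff ℓ N).1 hN.2)
      (fun M hM h => ⟨hF ℓ M hM.1, (extConcentrated_ofNat_iff ℓ _).2 h⟩)
      (fun N hN h => ⟨hG ℓ N hN.1, (torConcentrated_ofNat_iff ℓ _).2 h⟩)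
  -- For negative ℓ, concentration in degree ℓ means that every derived functor vanishes, which
  -- forces the module to be zero.
  · refine restrictsToAdjointEquivalence_of_isZero _ _ _ _
      (fun M hM => hd.isZero_of_leftDerived fun n => hM.2 (Int.ofNat n) (by simp))
      (fun N hN => hd.isZero_of_rightDerived fun n => hN.2 (Int.ofNat n) (by simp))
      (fun _ => isZero_punit Γ) (fun _ => isZero_punit Λ)
      (fun _ _ => ⟨hQ _ (isZero_punit Γ), extConcentrated_of_isZero _ (isZero_punit Γ)⟩)
      (fun _ _ => ⟨hP _ (isZero_punit Λ), torConcentrated_of_isZero _ (isZero_punit Λ)⟩)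

end Bimod

end

/-! ### The theorem for all modules and for finitely generated modules -/

theorem corollary4p2 (Γ Λ : Type u) [Ring Γ] [Ring Λ]
    (T : Type u) [AddCommGroup T] [Module Γ T] [Module Λᵐᵒᵖ T] [SMulCommClass Γ Λᵐᵒᵖ T]
    (hT : Bimod.IsWakamatsuTilting Γ Λ T)
    (hpdΓ : projectiveDimension (ModuleCat.of Γ T) ≠ ⊤)
    (hpdΛ : projectiveDimension (ModuleCat.of Λᵐᵒᵖ T) ≠ ⊤) :
    (∀ ℓ : ℤ, Bimod.RestrictsToAdjointEquivalence
      (Bimod.torFunctor Γ Λ T ℓ) (Bimod.extFunctor Γ Λ T ℓ)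
      (Bimod.torConcentrated Γ Λ T ℓ) (Bimod.extConcentrated Γ Λ T ℓ)) ∧
    (Bimod.IsArtinAlgebra Γ → Bimod.IsArtinAlgebra Λ →
      Module.Finite Γ T → Module.Finite Λᵐᵒᵖ T →
      ∀ ℓ : ℤ, Bimod.RestrictsToAdjointEquivalence
        (Bimod.torFunctor Γ Λ T ℓ) (Bimod.extFunctor Γ Λ T ℓ)
        (Bimod.fg Λ ⊓ Bimod.torConcentrated Γ Λ T ℓ)
        (Bimod.fg Γ ⊓ Bimod.extConcentrated Γ Λ T ℓ)) := by
  have hd := hT.derivesToEquivalence hpdΓ hpdΛ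
  refine ⟨fun ℓ => ?_, fun hΓ hΛ _ _ ℓ => ?_⟩
  · have h := Bimod.restrictsToAdjointEquivalence_concentrated hd ⊤ ⊤ (fun _ _ => trivial)
      (fun _ _ => trivial) (fun _ _ _ => trivial) (fun _ _ _ => trivial) ℓ
    rwa [top_inf_eq, top_inf_eq] at h
  · have := hΓ.isNoetherianRing
    have := hΛ.isNoetherianRing
    refine Bimod.restrictsToAdjointEquivalence_concentrated hd (Bimod.fg Λ) (Bimod.fg Γ)
      (fun M hM => ?_) (fun N hN => ?_) (fun n M hM => Bimod.finite_leftDerived M hM n)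
      (fun n N hN => Bimod.finite_rightDerived hΓ hT.homothety_right N hN n) ℓ
    · have := ModuleCat.subsingleton_of_isZero hM
      exact Module.Finite.of_finite
    · have := ModuleCat.subsingleton_of_isZero hN
      exact Module.Finite.of_finite
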